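/- **Setting.** Let $r$ be the rank, $A$ a finite set (the alphabet) and $M_1,\dots,M_r$ matrices indexed by $A\times A$. For $m\in\mathbb Z_+^r$ let $W_m$ be the set of words of shape $m$, i.e. maps $w:[0,m]\to A$ with $M_j(w(l+e_j),w(l))=1$ whenever $l,l+e_j\in[0,m]$; put $o(w)=w(0)$, $t(w)=w(m)$, and for $k+n\le m$ define $w|_{[k,k+n]}\in W_n$ by $i\mapsto w(k+i)$. For $p\in\mathbb Z^r$, $p\neq0$, a word $w\in W_m$ is $p$-periodic if $w(k)=w(k')$ whenever $k,k'\in[0,m]$ and $k'=p+k$. Assume: * (H0) each $M_j$ is a nonzero $\{0,1\}$-matrix; * (H1) if $u\in W_m$, $v\in W_n$ and $t(u)=o(v)$, there is a unique $w\in W_{m+n}$, written $w=uv$, with $w|_{[0,m]}=u$ and $w|_{[m,m+n]}=v$; * (H2) the directed graph with vertex set $A$ and an edge from $a$ to $b$ for each $i$ with $M_i(b,a)=1$ is irreducible; * (H3) for every $p\in\mathbb Z^r$, $p\ne0$, there is a word which is not $p$-periodic. A decoration is a nonempty finite or countable set $D$ with a map $\delta:D\to A$. The decorated words are the pairs $u=(d,w)$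 with $d\in D$, $w$ a word and $o(w)=\delta(d)$; the shape of $u$ is that of $w$, $t(u)=t(w)$, and $(d,w)w'=(d,ww')$ when $t(w)=o(w')$. Let $\mathcal A_D$ be the universal $C^*$-algebra generated by elements $s_{u,v}$, for all decorated words $u,v$ with $t(u)=t(v)$, subject to the relations $$s_{u,v}^*=s_{v,u},\qquad s_{u,v}s_{v,w}=s_{u,w},\qquad s_{u,v}=\sum_{w\in W_{e_j},\ o(w)=t(u)}s_{uw,vw}\quad(1\le j\le r),$$ $$s_{u,u}s_{v,v}=0\quad\text{for distinct } u,v \text{ of shape } 0 .$$ Let $\mathcal K$ be the $C^*$-algebra of compact operators on $\ell^2(\mathbb N)$, and let $\mathcal A_{A\times\mathbb N}$ be the algebra of the decoration $A\times\mathbb N\to A$, $(a,i)\mapsto a$. **Corollary 5.13.** Fix $A$ and $M_1,\dots,M_r$ as above. For every nonempty finite or countable set $D$ and every map $\delta:D\to A$ there is a $*$-isomorphism $\mathcal A_D\otimes\mathcal K\cong\mathcal A_{A\times\mathbb N}$. In particular the isomorphism class of $\mathcal A_D\otimes\mathcal K$ does not depend on the decoration: for any two decorations $(D,\delta)$ and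 $(D',\delta')$, $\mathcal A_D\otimes\mathcal K\cong\mathcal A_{D'}\otimes\mathcal K$. -/

import Mathlib

open scoped ENNReal

noncomputable section

universe u v

namespace HigherRankCK

/-! ### Words -/

section Words

variable {r : ℕ} {A : Type u}

/-- `W_m`: the words of shape `m ∈ ℤ₊ʳ`, that is, the maps `w : [0,m] → A` such that
`M_j(w(l + e_j), w(l)) = 1` whenever `l, l + e_j ∈ [0,m]`. -/
structure Word (M : Fin r → Matrix A A ℕ) (m : Fin r → ℕ) where
  toFun : Set.Iic m → A
  adj : ∀ (j : Fin r) (l : Fin r → ℕ) (hl : l ≤ m) (hl' : l + Pi.single j 1 ≤ m),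
    M j (toFun ⟨l + Pi.single j 1, hl'⟩) (toFun ⟨l, hl⟩) = 1

namespace Word

variable {M : Fin r → Matrix A A ℕ} {m n : Fin r → ℕ}

/-- The origin `o(w) = w(0)`. -/
def o (w : Word M m) : A := w.toFun ⟨0, fun _ => Nat.zero_le _⟩

/-- The terminus `t(w) = w(m)`. -/
def t (w : Word M m) : A := w.toFun ⟨m, le_refl m⟩

/-- The restriction `w|_{[k,k+n]} ∈ W_n`, given by `i ↦ w(i + k)`. -/
def restrict (w : Word M m) (k n : Fin r → ℕ) (h : k + n ≤ m) : Word M n where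
  toFun i := w.toFun ⟨k + i.1, (add_le_add_right i.2 k).trans h⟩
  adj j l hl hl' := by
    have h' : k + l + Pi.single j 1 ≤ m := by
      rw [add_assoc]; exact (add_le_add_right hl' k).trans h
    have := w.adj j (k + l) ((add_le_add_right hl k).trans h) h'
    simpa only [add_assoc] using this

/-- `w` is `p`-periodic if `w` and its translate `τ_p w : [p, p+m] → A`, `(τ_p w)(p + k) = w(k)`,
agree on `[0,m] ∩ [p,p+m]`: whenever `k` and `k' = p + k` both lie in `[0,m]`, then
`w(k) = w(k')`. -/
def IsPeriodic (w : Word M m) (p : Fin r → ℤ) : Prop :=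
  ∀ (k k' : Set.Iic m), (∀ i, (k'.1 i : ℤ) = p i + (k.1 i : ℤ)) → w.toFun k = w.toFun k'

instance [Finite A] : Finite (Word M m) :=
  Finite.of_injective (fun w : Word M m => w.toFun) (by rintro ⟨_, _⟩ ⟨_, _⟩ h; cases h; rfl)

end Word

/-- Existence and uniqueness of products of words: if `u ∈ W_m`, `v ∈ W_n` and `t(u) = o(v)`, there
is a unique `w ∈ W_{m+n}` with `w|_{[0,m]} = u` and `w|_{[m,m+n]} = v`. -/
def UniqueProducts (M : Fin r → Matrix A A ℕ) : Prop :=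
  ∀ (m n : Fin r → ℕ) (u : Word M m) (v : Word M n), u.t = v.o →
    ∃! w : Word M (m + n),
      w.restrict 0 m (by simp) = u ∧ w.restrict m n le_rfl = v

/-- The conditions (H0)-(H3) on the transition matrices. -/
structure TilingConditions (M : Fin r → Matrix A A ℕ) : Prop where
  /-- (H0): each `M_j` is a `{0,1}`-matrix. -/
  zero_one : ∀ j b a, M j b a = 0 ∨ M j b a = 1
  /-- (H0): each `M_j` is nonzero. -/
  ne_zero : ∀ j, M j ≠ 0
  /-- (H1). -/
  uniqueProducts : UniqueProducts M
  /-- (H2): the directed graph with an edge from `a` to `b` for each `i` such that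
  `M_i(b,a) = 1` is irreducible. -/
  irreducible : ∀ a b : A, Relation.ReflTransGen (fun a b => ∃ i, M i b a = 1) a b
  /-- (H3). -/
  aperiodic : ∀ p : Fin r → ℤ, p ≠ 0 → ∃ (m : Fin r → ℕ) (w : Word M m), ¬ w.IsPeriodic p

variable {M : Fin r → Matrix A A ℕ}

/-- The product `uv ∈ W_{m+n}` of `u ∈ W_m` and `v ∈ W_n`, where `t(u) = o(v)`. -/
def Word.mul (h1 : UniqueProducts M) {m n : Fin r → ℕ} (u : Word M m) (v : Word M n)
    (h : u.t = v.o) : Word M (m + n) :=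
  (h1 m n u v h).choose

theorem Word.mul_restrict_left (h1 : UniqueProducts M) {m n : Fin r → ℕ} (u : Word M m)
    (v : Word M n) (h : u.t = v.o) : (u.mul h1 v h).restrict 0 m (by simp) = u :=
  (h1 m n u v h).choose_spec.1.1

theorem Word.mul_restrict_right (h1 : UniqueProducts M) {m n : Fin r → ℕ} (u : Word M m)
    (v : Word M n) (h : u.t = v.o) : (u.mul h1 v h).restrict m n le_rfl = v :=
  (h1 m n u v h).choose_spec.1.2

theorem Word.mul_o (h1 : UniqueProducts M) {m n : Fin r → ℕ} (u : Word M m)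
    (v : Word M n) (h : u.t = v.o) : (u.mul h1 v h).o = u.o := by
  conv_rhs => rw [← u.mul_restrict_left h1 v h]
  simp [Word.o, Word.restrict]

theorem Word.mul_t (h1 : UniqueProducts M) {m n : Fin r → ℕ} (u : Word M m)
    (v : Word M n) (h : u.t = v.o) : (u.mul h1 v h).t = v.t := by
  conv_rhs => rw [← u.mul_restrict_right h1 v h]
  simp [Word.t, Word.restrict]

/-- The words `w` of shape `e_j` with `o(w) = a`. -/
abbrev Edge (M : Fin r → Matrix A A ℕ) (j : Fin r) (a : A) : Type u :=
  {w : Word M (Pi.single j 1) // w.o = a}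

instance [Finite A] (j : Fin r) (a : A) : Fintype (Edge M j a) := Fintype.ofFinite _

variable {D : Type v}

/-- The decorated words: pairs `(d, w)` with `d ∈ D`, `w` a word of some shape, and
`o(w) = δ(d)`. -/
structure DWord (M : Fin r → Matrix A A ℕ) (δ : D → A) where
  shape : Fin r → ℕ
  dec : D
  word : Word M shape
  o_eq : word.o = δ dec

namespace DWord

variable {δ : D → A}

/-- The terminus of a decorated word: `t(d, w) = t(w)`. -/
def t (u : DWord M δ) : A := u.word.t

/-- The product `(d, u)w = (d, uw)`. -/
def mul (h1 : UniqueProducts M) (u : DWord M δ) {n : Fin r → ℕ} (w : Word M n)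
    (h : w.o = u.t) : DWord M δ where
  shape := u.shape + n
  dec := u.dec
  word := u.word.mul h1 w h.symm
  o_eq := (u.word.mul_o h1 w h.symm).trans u.o_eq

theorem mul_t (h1 : UniqueProducts M) (u : DWord M δ) {n : Fin r → ℕ} (w : Word M n)
    (h : w.o = u.t) : (u.mul h1 w h).t = w.t :=
  u.word.mul_t h1 w h.symm

end DWord

end Words

/-! ### Concretely generated `C*`-algebras of operators -/

section ProductOfBH

/-- A complex Hilbert space. All `C*`-algebras below are separable, so that their representations
are direct sums of representations on separable Hilbert spaces, and nothing is lost by taking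
Hilbert spaces in the universe `Type`. -/
structure Hilb : Type 1 where
  carrier : Type
  [normed : NormedAddCommGroup carrier]
  [inner : InnerProductSpace ℂ carrier]
  [complete : CompleteSpace carrier]

attribute [instance] Hilb.normed Hilb.inner Hilb.complete

/-- The bounded operators on a Hilbert space. -/
abbrev Hilb.B (H : Hilb) : Type := H.carrier →L[ℂ] H.carrier

/-- The smallest norm-closed `*`-subalgebra of a `C*`-algebra which contains the set `s`. -/
def closedStarSpan {B : Type*} [NonUnitalCStarAlgebra B] (s : Set B) :
    NonUnitalStarSubalgebra ℂ B :=
  (NonUnitalStarAlgebra.adjoin ℂ s).topologicalClosure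

instance {B : Type*} [NonUnitalCStarAlgebra B] (s : Set B) :
    IsClosed (closedStarSpan s : Set B) :=
  NonUnitalStarSubalgebra.isClosed_topologicalClosure _

end ProductOfBH

/-! ### The algebra `𝒜_D` -/

section TilingAlgebra

variable {r : ℕ} {A : Type u} [Finite A] {M : Fin r → Matrix A A ℕ} {D : Type v}

/-- The defining relations for a family `s_{u,v}`, indexed by the pairs of decorated words
`u, v` with `t(u) = t(v)`. -/
structure Relations (h1 : UniqueProducts M) (δ : D → A) {B : Type*} [NonUnitalRing B] [StarRing B]
    (s : ∀ u v : DWord M δ, u.t = v.t → B) : Prop where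
  /-- `s_{u,v}* = s_{v,u}`. -/
  star_eq : ∀ u v (h : u.t = v.t), star (s u v h) = s v u h.symm
  /-- `s_{u,v} s_{v,w} = s_{u,w}`. -/
  mul_eq : ∀ u v w (h : u.t = v.t) (h' : v.t = w.t),
    s u v h * s v w h' = s u w (h.trans h')
  /-- `s_{u,v} = ∑ s_{uw,vw}`, the sum over the words `w` of shape `e_j` with
  `o(w) = t(u) = t(v)`. -/
  sum_eq : ∀ u v (h : u.t = v.t) (j : Fin r),
    s u v h = ∑ w : Edge M j u.t,
      s (u.mul h1 w.1 w.2) (v.mul h1 w.1 (w.2.trans h))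
        ((u.mul_t h1 w.1 w.2).trans (v.mul_t h1 w.1 (w.2.trans h)).symm)
  /-- `s_{u,u} s_{v,v} = 0` for distinct `u, v` of shape `0`. -/
  orthogonal : ∀ u v : DWord M δ, u.shape = 0 → v.shape = 0 → u ≠ v →
    s u u rfl * s v v rfl = 0

theorem Relations.norm_le_one {h1 : UniqueProducts M} {δ : D → A} {B : Type*}
    [NonUnitalNormedRing B] [StarRing B] [CStarRing B]
    {s : ∀ u v : DWord M δ, u.t = v.t → B} (hs : Relations h1 δ s)
    (u v : DWord M δ) (h : u.t = v.t) : ‖s u v h‖ ≤ 1 := by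
  have key : ∀ u v (h : u.t = v.t), ‖s u v h‖ * ‖s u v h‖ = ‖s v v rfl‖ := fun u v h => by
    rw [← CStarRing.norm_star_mul_self, hs.star_eq, hs.mul_eq]
  have h2 := key u v h
  have h3 := key v v rfl
  have h4 := norm_nonneg (s u v h)
  have h5 : ‖s v v rfl‖ ≤ 1 := by
    by_contra! h6
    nlinarith
  by_contra! h6
  nlinarith

/-- A representation of the generators and relations on a Hilbert space. -/
structure Rep (h1 : UniqueProducts M) (δ : D → A) : Type (max 1 u v) where
  H : Hilb
  S : ∀ u v : DWord M δ, u.t = v.t → H.B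
  rel : Relations h1 δ S

/-- The universal family: the direct sum over all representations `(S_{u,v})` of the defining
relations on Hilbert spaces. -/
def gen (h1 : UniqueProducts M) (δ : D → A) (u v : DWord M δ) (h : u.t = v.t) :
    lp (fun ρ : Rep h1 δ => ρ.H.B) ∞ :=
  ⟨fun ρ => ρ.S u v h, memℓp_infty ⟨1, by rintro _ ⟨ρ, rfl⟩; exact ρ.rel.norm_le_one u v h⟩⟩

/-- The algebra `𝒜_D`: the universal `C*`-algebra generated by elements `s_{u,v}` subject to the
defining relations, realized as the `C*`-algebra generated by the universal family. Its norm is thus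
the supremum of the norms in all representations of the relations on Hilbert spaces. -/
def TilingAlgebra (h1 : UniqueProducts M) (δ : D → A) : Type (max 1 u v) :=
  closedStarSpan {x | ∃ u v h, x = gen h1 δ u v h}

instance (h1 : UniqueProducts M) (δ : D → A) : NonUnitalCStarAlgebra (TilingAlgebra h1 δ) :=
  inferInstanceAs (NonUnitalCStarAlgebra (closedStarSpan {x | ∃ u v h, x = gen h1 δ u v h}))

end TilingAlgebra

/-! ### The compact operators -/

section Compact

theorem isCompactOperator_star {E : Type*} [NormedAddCommGroup E] [InnerProductSpace ℂ E]
    [CompleteSpace E] (T : E →L[ℂ] E) (hT : IsCompactOperator T) :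
    IsCompactOperator (star T : E →L[ℂ] E) := by
  have hTT : IsCompactOperator ((T * star T : E →L[ℂ] E) : E →ₗ[ℂ] E) := hT.comp_clm (star T)
  have tb := (hTT.isCompact_closure_image_closedBall 1).totallyBounded.subset subset_closure
  have key : TotallyBounded (((star T : E →L[ℂ] E) : E →ₗ[ℂ] E) '' Metric.closedBall 0 1) := by
    rw [Metric.totallyBounded_iff]
    intro ε hε
    obtain ⟨s, hs, hsf, hcov⟩ := Metric.finite_approx_of_totallyBounded tb (ε ^ 2 / 2)
      (by positivity)
    choose! g hg using fun z (hz : z ∈ s) => (Set.mem_image _ _ _).1 (hs hz)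
    refine ⟨(fun z => star T (g z)) '' s, hsf.image _, ?_⟩
    rintro _ ⟨x, hx, rfl⟩
    obtain ⟨z, hz, hxz⟩ := Set.mem_iUnion₂.1 (hcov ⟨x, hx, rfl⟩)
    refine Set.mem_iUnion₂.2 ⟨_, ⟨z, hz, rfl⟩, ?_⟩
    obtain ⟨hgb, hgz⟩ := hg z hz
    rw [← hgz, Metric.mem_ball, dist_eq_norm, ← map_sub] at hxz
    rw [Metric.mem_ball, dist_eq_norm]
    change ‖star T x - star T (g z)‖ < ε
    rw [← map_sub]
    set y := x - g z with hy
    have hyn : ‖y‖ ≤ 2 := by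
      have h1 : ‖x‖ ≤ 1 := by simpa using hx
      have h2 : ‖g z‖ ≤ 1 := by simpa using hgb
      exact (norm_sub_le _ _).trans (by linarith)
    have h3 : ‖star T y‖ ^ 2 ≤ ‖T (star T y)‖ * ‖y‖ := by
      have h4 := ContinuousLinearMap.adjoint_inner_right T (star T y) y
      rw [← ContinuousLinearMap.star_eq_adjoint] at h4
      have h5 : ‖inner ℂ (star T y) (star T y)‖ = ‖star T y‖ ^ 2 := by
        rw [inner_self_eq_norm_sq_to_K]; simp
      rw [← h5, h4]
      exact norm_inner_le_norm _ _
    have h6 : ‖T (star T y)‖ < ε ^ 2 / 2 := hxz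
    have h7 := norm_nonneg (T (star T y))
    have h8 : ‖star T y‖ ^ 2 < ε ^ 2 := by nlinarith
    exact lt_of_pow_lt_pow_left₀ 2 hε.le h8
  exact (isCompactOperator_iff_isCompact_closure_image_closedBall
    ((star T : E →L[ℂ] E) : E →ₗ[ℂ] E) zero_lt_one).2
    (TotallyBounded.isCompact_of_isClosed (TotallyBounded.closure key) isClosed_closure)

/-- The Hilbert space `ℓ²(ℕ)`. -/
abbrev EllTwo : Type := lp (fun _ : ℕ => ℂ) 2

/-- The `C*`-algebra `𝒦` of compact operators on `ℓ²(ℕ)`. -/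
def compacts : NonUnitalStarSubalgebra ℂ (EllTwo →L[ℂ] EllTwo) where
  carrier := {T | IsCompactOperator T}
  add_mem' ha hb := ha.add hb
  zero_mem' := isCompactOperator_zero
  mul_mem' {_ b} ha _ := ha.comp_clm b
  smul_mem' c _ ha := ha.smul c
  star_mem' {a} ha := isCompactOperator_star a ha

instance : IsClosed (compacts : Set (EllTwo →L[ℂ] EllTwo)) :=
  isClosed_setOfPred_isCompactOperator

end Compact

/-! ### Tensor products of `C*`-algebras -/

section Tensor

variable (A : Type u) (B : Type v) [NonUnitalCStarAlgebra A] [NonUnitalCStarAlgebra B]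

/-- A pair of commuting representations of `A` and `B` on a Hilbert space. -/
structure CommutingPair : Type (max 1 u v) where
  H : Hilb
  π : A →⋆ₙₐ[ℂ] H.B
  σ : B →⋆ₙₐ[ℂ] H.B
  comm : ∀ a b, Commute (π a) (σ b)

variable {A B}

/-- The elementary tensor `a ⊗ b`, which acts as `π(a)σ(b)` in each commuting pair `(π, σ)`. -/
def tmul (a : A) (b : B) : lp (fun ρ : CommutingPair A B => ρ.H.B) ∞ :=
  ⟨fun ρ => ρ.π a * ρ.σ b, memℓp_infty ⟨‖a‖ * ‖b‖, by
    rintro _ ⟨ρ, rfl⟩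
    exact (norm_mul_le _ _).trans (mul_le_mul (NonUnitalStarAlgHom.norm_apply_le ρ.π a)
      (NonUnitalStarAlgHom.norm_apply_le ρ.σ b) (norm_nonneg _) (norm_nonneg _))⟩⟩

variable (A B)

/-- The `C*`-tensor product of two separable `C*`-algebras: the completion of the algebraic tensor
product in the norm `‖∑ aᵢ ⊗ bᵢ‖ = sup ‖∑ π(aᵢ)σ(bᵢ)‖`, the supremum over all commuting pairs
`(π, σ)` of representations on a Hilbert space. This is the largest `C*`-norm on the algebraic tensor
product. It is the only one if `A` or `B` is nuclear, as is the algebra of compact operators. -/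
def CStarTensor : Type (max 1 u v) :=
  closedStarSpan {x : lp (fun ρ : CommutingPair A B => ρ.H.B) ∞ | ∃ a b, x = tmul a b}

instance : NonUnitalCStarAlgebra (CStarTensor A B) :=
  inferInstanceAs (NonUnitalCStarAlgebra (closedStarSpan
    {x : lp (fun ρ : CommutingPair A B => ρ.H.B) ∞ | ∃ a b, x = tmul a b}))

/-- The stabilization `A ⊗ 𝒦`. -/
abbrev Stabilization : Type (max 1 u) := CStarTensor A compacts

end Tensor

end HigherRankCK

end

noncomputable section

universe u v

namespace HigherRankCK

/-! ### Combinatorics of words -/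

section WordLemmas

variable {r : ℕ} {A : Type u} {M : Fin r → Matrix A A ℕ}

namespace Word

/-! The isomorphism passes through the decoration `multiple δ`, in which each `d ∈ D` occurs in
countably many copies `(d,i)`. It is composed from `𝒜_D ⊗ 𝒦 ≅ 𝒜_{D×ℕ}` (`stabEquiv`) and `𝒜_{D×ℕ} ≅
𝒜_{A×ℕ}` (`Refinement.equiv`, applied to `exists_refinement`).

The relations state orthogonality only for words of shape `0`. The rest comes from a Hilbert space
fact: projections whose sum is a projection are mutually orthogonal
(`orthogonal_of_sum_projections`). Hence `s_{u,u} s_{v,v} = 0` whenever `u` and `v` have no common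
extension, which is what every verification of the relations needs.

Change of decoration: since `s_{u,v}` is the sum of the `s_{uw,vw}` over all `w` of any fixed shape,
the algebra is determined by the decorated words of large shape. So a decoration may be replaced by
the words of a chosen shape that start from it, provided the chosen shapes are bounded.
Irreducibility allows shapes, depending on the copy number, for which every letter is the terminus
of infinitely many of these words. A countable set with infinite fibres over `A` is a copy of `A ×
ℕ`.

Stabilization: the map is `s_{(u,i),(v,j)} ↦ s_{u,v} ⊗ e_{ij}`. To see that it is isometric, take a
representation `ρ` of the relations for `D × ℕ` on `H`. The operators with copy number `0` represent
`𝒜_D`, and their amplification represents `𝒜_D ⊗ 𝒦` on `H ⊗ ℓ²`. The sums `h ↦ ∑ S_{(d,0),(d,i)} h ⊗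
e_i` intertwine `ρ` with this amplification and preserve norms on the ranges of the vertex
projections, so `‖ρ(a)‖` is at most the norm of the image of `a`. Finite sums suffice for elements
of a dense subalgebra. The range is then closed and contains all `s_{u,v} ⊗ e_{ij}`, so it is
everything. -/

theorem ext_apply {m : Fin r → ℕ} {w w' : Word M m} (h : ∀ l, w.toFun l = w'.toFun l) :
    w = w' := by
  obtain ⟨f, hf⟩ := w
  obtain ⟨g, hg⟩ := w'
  have : f = g := funext h
  subst this
  rfl

theorem mul_apply_left (h1 : UniqueProducts M) {m n : Fin r → ℕ} (u : Word M m) (v : Word M n)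
    (h : u.t = v.o) (l : Fin r → ℕ) (hl : l ≤ m) (hl' : l ≤ m + n) :
    (u.mul h1 v h).toFun ⟨l, hl'⟩ = u.toFun ⟨l, hl⟩ := by
  have := congrArg (fun w : Word M m => w.toFun ⟨l, hl⟩) (u.mul_restrict_left h1 v h)
  simpa [restrict] using this

theorem mul_apply_right (h1 : UniqueProducts M) {m n : Fin r → ℕ} (u : Word M m) (v : Word M n)
    (h : u.t = v.o) (l : Fin r → ℕ) (hl : l ≤ n) (hl' : m + l ≤ m + n) :
    (u.mul h1 v h).toFun ⟨m + l, hl'⟩ = v.toFun ⟨l, hl⟩ := by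
  have := congrArg (fun w : Word M n => w.toFun ⟨l, hl⟩) (u.mul_restrict_right h1 v h)
  simpa [restrict] using this

theorem restrict_o {m : Fin r → ℕ} (w : Word M m) (k n : Fin r → ℕ) (h : k + n ≤ m) :
    (w.restrict k n h).o = w.toFun ⟨k, le_self_add.trans h⟩ := by
  simp [o, restrict]

theorem restrict_t {m : Fin r → ℕ} (w : Word M m) (k n : Fin r → ℕ) (h : k + n ≤ m) :
    (w.restrict k n h).t = w.toFun ⟨k + n, h⟩ := rfl

theorem restrict_zero_o {m : Fin r → ℕ} (w : Word M m) (n : Fin r → ℕ) (h : 0 + n ≤ m) :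
    (w.restrict 0 n h).o = w.o := restrict_o w 0 n h

theorem restrict_t_eq_restrict_o {m : Fin r → ℕ} (w : Word M m) (k n p : Fin r → ℕ)
    (h : k + n ≤ m) (h' : k + n + p ≤ m) :
    (w.restrict k n h).t = (w.restrict (k + n) p h').o := by
  rw [restrict_t, restrict_o]

theorem eq_of_restrict_eq (h1 : UniqueProducts M) {m n : Fin r → ℕ} {x y : Word M (m + n)}
    (hl : x.restrict 0 m (by simp) = y.restrict 0 m (by simp))
    (hr : x.restrict m n le_rfl = y.restrict m n le_rfl) : x = y := by
  have h : (y.restrict 0 m (by simp)).t = (y.restrict m n le_rfl).o := by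
    rw [restrict_t, restrict_o]; simp
  exact (h1 m n _ _ h).unique ⟨hl, hr⟩ ⟨rfl, rfl⟩

/-- By uniqueness in (H1), the two corner boxes `[0,m]` and `[m,m+n]` determine a word on all of
`[0,m+n]`. -/
theorem eq_of_agree (h1 : UniqueProducts M) {m n : Fin r → ℕ} {x y : Word M (m + n)}
    (hl : ∀ l (_ : l ≤ m) (h : l ≤ m + n), x.toFun ⟨l, h⟩ = y.toFun ⟨l, h⟩)
    (hr : ∀ l (_ : l ≤ n) (h : m + l ≤ m + n), x.toFun ⟨m + l, h⟩ = y.toFun ⟨m + l, h⟩) :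
    x = y := by
  refine eq_of_restrict_eq h1 (ext_apply fun l => ?_) (ext_apply fun l => ?_)
  · exact hl _ ((zero_add l.1).le.trans l.2) _
  · exact hr _ l.2 _

end Word

variable {D : Type v} {δ : D → A}

namespace DWord

theorem ext_apply {u v : DWord M δ} (hs : u.shape = v.shape) (hd : u.dec = v.dec)
    (hw : ∀ l (hl : l ≤ u.shape) (hl' : l ≤ v.shape),
      u.word.toFun ⟨l, hl⟩ = v.word.toFun ⟨l, hl'⟩) : u = v := by
  obtain ⟨n, d, w, hw1⟩ := u
  obtain ⟨n', d', w', hw2⟩ := v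
  obtain rfl : n = n' := hs
  obtain rfl : d = d' := hd
  obtain rfl : w = w' := Word.ext_apply fun l => hw l.1 l.2 l.2
  rfl

theorem apply_congr {u v : DWord M δ} (h : u = v) (l : Fin r → ℕ) (hl : l ≤ u.shape)
    (hl' : l ≤ v.shape) : u.word.toFun ⟨l, hl⟩ = v.word.toFun ⟨l, hl'⟩ := by
  subst h; rfl

theorem eq_of_agree (h1 : UniqueProducts M) {u v : DWord M δ} (m n : Fin r → ℕ)
    (hu : u.shape = m + n) (hv : v.shape = m + n) (hd : u.dec = v.dec)
    (hl : ∀ l (_ : l ≤ m) (h : l ≤ u.shape) (h' : l ≤ v.shape),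
      u.word.toFun ⟨l, h⟩ = v.word.toFun ⟨l, h'⟩)
    (hr : ∀ l (_ : l ≤ n) (h : m + l ≤ u.shape) (h' : m + l ≤ v.shape),
      u.word.toFun ⟨m + l, h⟩ = v.word.toFun ⟨m + l, h'⟩) : u = v := by
  obtain ⟨a, d, w, hw1⟩ := u
  obtain ⟨a', d', w', hw2⟩ := v
  obtain rfl : a = m + n := hu
  obtain rfl : a' = m + n := hv
  obtain rfl : d = d' := hd
  obtain rfl : w = w' := Word.eq_of_agree h1 (fun l h h' => hl l h h' h')
    (fun l h h' => hr l h h' h')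
  rfl

theorem mul_congr (h1 : UniqueProducts M) {u v : DWord M δ} (h : u = v) {n : Fin r → ℕ}
    {w w' : Word M n} (hw : w = w') (hu : w.o = u.t) (hv : w'.o = v.t) :
    u.mul h1 w hu = v.mul h1 w' hv := by
  subst h; subst hw; rfl

/-- The shapes on the two sides are only propositionally equal; bundling the shape into `DWord`
makes this an honest equation. It is checked on the two corner boxes cut at `u.shape`, and the upper
one is cut again at `m`. -/
theorem mul_mul (h1 : UniqueProducts M) (u : DWord M δ) {m n : Fin r → ℕ} (w : Word M m)
    (w' : Word M n) (h : w.o = u.t) (h' : w.t = w'.o) :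
    (u.mul h1 w h).mul h1 w' (h'.symm.trans (u.mul_t h1 w h).symm) =
      u.mul h1 (w.mul h1 w' h') ((w.mul_o h1 w' h').trans h) := by
  have key : ∀ l (hl : l ≤ m + n) (hl' : u.shape + l ≤ (u.shape + m) + n),
      ((u.mul h1 w h).mul h1 w' (h'.symm.trans (u.mul_t h1 w h).symm)).word.toFun
        ⟨u.shape + l, hl'⟩ = (w.mul h1 w' h').toFun ⟨l, hl⟩ := by
    have : (((u.mul h1 w h).mul h1 w' (h'.symm.trans (u.mul_t h1 w h).symm)).word.restrict
        u.shape (m + n) (by simp [mul, add_assoc])) = w.mul h1 w' h' := by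
      refine Word.eq_of_agree h1 (fun l hl hl' => ?_) (fun l hl hl' => ?_)
      · rw [Word.mul_apply_left h1 _ _ _ _ hl]
        refine (Word.mul_apply_left h1 (u.mul h1 w h).word w' _ (u.shape + l)
          (add_le_add_right hl _) _).trans ?_
        exact Word.mul_apply_right h1 u.word w h.symm l hl _
      · rw [Word.mul_apply_right h1 _ _ _ _ hl]
        refine Eq.trans ?_ (Word.mul_apply_right h1 (u.mul h1 w h).word w'
          ((u.mul_t h1 w h).trans h') l hl
          (add_le_add_right hl _))
        simp only [Word.restrict]
        congr 2
        exact (add_assoc _ _ _).symm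
    intro l hl hl'
    rw [← this]; rfl
  refine eq_of_agree h1 u.shape (m + n) (add_assoc _ _ _) rfl rfl (fun l hl h₁ h₂ => ?_)
    (fun l hl h₁ h₂ => ?_)
  · refine (Word.mul_apply_left h1 (u.mul h1 w h).word w' ((u.mul_t h1 w h).trans h') l
      (hl.trans le_self_add) _).trans ?_
    exact (Word.mul_apply_left h1 u.word w h.symm l hl _).trans
      (Word.mul_apply_left h1 u.word _ ((w.mul_o h1 w' h').trans h).symm l hl _).symm
  · exact (key l hl h₁).trans (Word.mul_apply_right h1 u.word _
      ((w.mul_o h1 w' h').trans h).symm l hl _).symm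

theorem eq_of_mul_eq_mul (h1 : UniqueProducts M) {u v : DWord M δ} {m n : Fin r → ℕ}
    {w : Word M m} {w' : Word M n} {hu : w.o = u.t} {hv : w'.o = v.t}
    (hs : u.shape = v.shape) (h : u.mul h1 w hu = v.mul h1 w' hv) : u = v := by
  refine ext_apply hs (by simpa [mul] using congrArg DWord.dec h) fun l hl hl' => ?_
  refine (Word.mul_apply_left h1 u.word w hu.symm l hl (hl.trans le_self_add)).symm.trans ?_
  refine Eq.trans ?_ (Word.mul_apply_left h1 v.word w' hv.symm l hl' (hl'.trans le_self_add))
  exact apply_congr h _ _ _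

theorem mul_left_cancel (h1 : UniqueProducts M) {u : DWord M δ} {n : Fin r → ℕ}
    {w w' : Word M n} {hu : w.o = u.t} {hv : w'.o = u.t}
    (h : u.mul h1 w hu = u.mul h1 w' hv) : w = w' := by
  refine Word.ext_apply fun l => ?_
  refine (Word.mul_apply_right h1 u.word w hu.symm l l.2 (add_le_add_right l.2 _)).symm.trans ?_
  refine Eq.trans ?_ (Word.mul_apply_right h1 u.word w' hv.symm l l.2 (add_le_add_right l.2 _))
  exact apply_congr h _ _ _

theorem exists_eq_mul (h1 : UniqueProducts M) (u : DWord M δ) {m : Fin r → ℕ}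
    (hm : m ≤ u.shape) : ∃ (v : DWord M δ) (n : Fin r → ℕ) (w : Word M n) (h : w.o = v.t),
      v.shape = m ∧ v.mul h1 w h = u := by
  obtain ⟨p, d, x, hx⟩ := u
  obtain ⟨n, rfl⟩ := exists_add_of_le hm
  have ht : (x.restrict 0 m (by simp)).t = (x.restrict m n le_rfl).o := by
    rw [Word.restrict_t, Word.restrict_o]; simp
  refine ⟨⟨m, d, x.restrict 0 m (by simp), (Word.restrict_zero_o _ _ _).trans hx⟩, n,
    x.restrict m n le_rfl, ht.symm, rfl, ?_⟩
  have : (x.restrict 0 m (by simp)).mul h1 (x.restrict m n le_rfl) ht = x :=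
    Word.eq_of_restrict_eq h1 (Word.mul_restrict_left h1 _ _ ht) (Word.mul_restrict_right h1 _ _ ht)
  simp only [mul, this]

end DWord

/-- The words of shape `n` with origin `a`. -/
abbrev Words (M : Fin r → Matrix A A ℕ) (n : Fin r → ℕ) (a : A) : Type u :=
  {w : Word M n // w.o = a}

instance [Finite A] (n : Fin r → ℕ) (a : A) : Fintype (Words M n a) := Fintype.ofFinite _

/-- A word of shape `m + n` amounts to a word of shape `m` followed by one of shape `n`. -/
def splitEquiv (h1 : UniqueProducts M) (m n : Fin r → ℕ) (a : A) :
    (Σ w : Words M m a, Words M n w.1.t) ≃ Words M (m + n) a where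
  toFun w := ⟨w.1.1.mul h1 w.2.1 w.2.2.symm, (Word.mul_o _ _ _ _).trans w.1.2⟩
  invFun x := ⟨⟨x.1.restrict 0 m (by simp), (Word.restrict_zero_o _ _ _).trans x.2⟩,
    ⟨x.1.restrict m n le_rfl, by
      have := Word.restrict_t_eq_restrict_o x.1 0 m n (by simp) (by simp)
      rw [this, Word.restrict_o, Word.restrict_o]; simp⟩⟩
  left_inv := by
    rintro ⟨⟨w, hw⟩, ⟨w', hw'⟩⟩
    refine Sigma.subtype_ext (Subtype.ext ?_) ?_
    · exact Word.mul_restrict_left h1 w w' hw'.symm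
    · exact Word.mul_restrict_right h1 w w' hw'.symm
  right_inv x := by
    have ht : (x.1.restrict 0 m (by simp)).t = (x.1.restrict m n le_rfl).o := by
      rw [Word.restrict_t, Word.restrict_o]; simp
    exact Subtype.ext (Word.eq_of_restrict_eq h1 (Word.mul_restrict_left h1 _ _ ht)
      (Word.mul_restrict_right h1 _ _ ht))

theorem sum_words_add [Finite A] (h1 : UniqueProducts M) (m n : Fin r → ℕ) (a : A) {B : Type*}
    [AddCommMonoid B] (f : Words M (m + n) a → B) :
    ∑ x, f x = ∑ w : Words M m a, ∑ w' : Words M n w.1.t,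
      f ⟨w.1.mul h1 w'.1 w'.2.symm, (Word.mul_o _ _ _ _).trans w.2⟩ := by
  refine Eq.trans ?_ (Fintype.sum_sigma (fun w : Σ w : Words M m a, Words M n w.1.t =>
    f (splitEquiv h1 m n a w)))
  exact (Fintype.sum_equiv (splitEquiv h1 m n a) _ _ fun _ => rfl).symm

instance (a : A) : Unique (Words M 0 a) where
  default := ⟨⟨fun _ => a, fun j l _ hl' => by
    have := hl' j
    simp at this⟩, rfl⟩
  uniq w := by
    refine Subtype.ext (Word.ext_apply fun l => ?_)
    have hl : l = ⟨0, fun _ => Nat.zero_le _⟩ :=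
      Subtype.ext (le_antisymm l.2 fun _ => Nat.zero_le _)
    rw [hl]
    exact w.2

theorem DWord.mul_words_zero (h1 : UniqueProducts M) (u : DWord M δ) (w : Word M 0)
    (h : w.o = u.t) : u.mul h1 w h = u :=
  DWord.ext_apply (add_zero _) rfl fun l hl hl' => Word.mul_apply_left h1 u.word w h.symm l hl' hl

/-- The decorated word of shape `0` with decoration `d`. -/
def DWord.vertex (M : Fin r → Matrix A A ℕ) (δ : D → A) (d : D) : DWord M δ :=
  ⟨0, d, (default : Words M 0 (δ d)).1, (default : Words M 0 (δ d)).2⟩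

theorem DWord.eq_vertex {u : DWord M δ} (hu : u.shape = 0) : u = DWord.vertex M δ u.dec := by
  obtain ⟨n, d, w, hw⟩ := u
  obtain rfl : n = 0 := hu
  have : (⟨w, hw⟩ : Words M 0 (δ d)) = default := Subsingleton.elim _ _
  obtain rfl : w = (default : Words M 0 (δ d)).1 := congrArg Subtype.val this
  rfl

theorem DWord.exists_eq_vertex_mul (h1 : UniqueProducts M) (u : DWord M δ) :
    ∃ h : u.word.o = (DWord.vertex M δ u.dec).t,
      (DWord.vertex M δ u.dec).mul h1 u.word h = u := by
  obtain ⟨n, d, w, hw⟩ := u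
  refine ⟨hw, DWord.ext_apply (zero_add _) rfl fun l hl hl' => ?_⟩
  refine Eq.trans ?_ (Word.mul_apply_right h1 (DWord.vertex M δ d).word w hw.symm l hl' ?_)
  · exact congrArg _ (Subtype.ext (zero_add l).symm)
  · exact add_le_add_right hl' _

end WordLemmas

/-! ### Consequences of the relations -/

theorem shape_induction {r : ℕ} {P : (Fin r → ℕ) → Prop} (h0 : P 0)
    (hs : ∀ n j, P n → P (n + Pi.single j 1)) (n : Fin r → ℕ) : P n := by
  obtain ⟨k, hk⟩ : ∃ k, ∑ i, n i = k := ⟨_, rfl⟩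
  induction k generalizing n with
  | zero =>
    have : n = 0 := by
      funext i
      simpa using (Finset.sum_eq_zero_iff.1 hk) i (Finset.mem_univ i)
    exact this ▸ h0
  | succ k ih =>
    obtain ⟨j, hj⟩ : ∃ j, n j ≠ 0 := by
      by_contra! h
      simp [h] at hk
    have hle : Pi.single j 1 ≤ n := by
      intro i
      by_cases hi : i = j
      · subst hi; simpa using Nat.one_le_iff_ne_zero.2 hj
      · simp [hi]
    obtain ⟨n', rfl⟩ := exists_add_of_le hle
    rw [add_comm]
    refine hs n' j (ih n' ?_)
    simp [Finset.sum_add_distrib] at hk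
    omega

section Relations

variable {r : ℕ} {A : Type u} {M : Fin r → Matrix A A ℕ} {D : Type v}
  {δ : D → A}

/-- The proof argument of `s` depends on both words, so equalities of words cannot simply be
rewritten under `s`. -/
theorem family_congr {B : Type*} (s : ∀ u v : DWord M δ, u.t = v.t → B) {u u' v v' : DWord M δ}
    (hu : u = u') (hv : v = v') (h : u.t = v.t) (h' : u'.t = v'.t) : s u v h = s u' v' h' := by
  subst hu hv; rfl

variable [Finite A] {h1 : UniqueProducts M}

namespace Relations

section General

variable {B : Type*} [NonUnitalRing B] [StarRing B] {s : ∀ u v : DWord M δ, u.t = v.t → B}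

/-- With the common terminus a free variable `a`, the index type of the sum no longer mentions `u`
or `v`. -/
theorem sum_edges (hs : Relations h1 δ s) (j : Fin r) (u v : DWord M δ) (a : A) (hu : u.t = a)
    (hv : v.t = a) : s u v (hu.trans hv.symm) = ∑ w : Words M (Pi.single j 1) a,
      s (u.mul h1 w.1 (w.2.trans hu.symm)) (v.mul h1 w.1 (w.2.trans hv.symm))
        ((u.mul_t h1 _ _).trans (v.mul_t h1 _ _).symm) := by
  subst hu
  rw [hs.sum_eq u v hv.symm j]

theorem sum_words (hs : Relations h1 δ s) (n : Fin r → ℕ) (u v : DWord M δ) (a : A)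
    (hu : u.t = a) (hv : v.t = a) : s u v (hu.trans hv.symm) = ∑ w : Words M n a,
      s (u.mul h1 w.1 (w.2.trans hu.symm)) (v.mul h1 w.1 (w.2.trans hv.symm))
        ((u.mul_t h1 _ _).trans (v.mul_t h1 _ _).symm) := by
  induction n using shape_induction with
  | h0 =>
    rw [Fintype.sum_unique]
    exact family_congr s (u.mul_words_zero h1 _ _).symm (v.mul_words_zero h1 _ _).symm _ _
  | hs n j ih =>
    rw [ih, sum_words_add h1]
    refine Finset.sum_congr rfl fun w _ => ?_
    rw [hs.sum_edges j _ _ w.1.t (u.mul_t h1 _ _) (v.mul_t h1 _ _)]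
    exact Finset.sum_congr rfl fun w' _ => family_congr s
      (u.mul_mul h1 w.1 w'.1 _ w'.2.symm) (v.mul_mul h1 w.1 w'.1 _ w'.2.symm) _ _

theorem map {B' : Type*} [NonUnitalRing B'] [StarRing B'] {F : Type*} [FunLike F B B']
    [NonUnitalRingHomClass F B B'] [StarHomClass F B B'] (hs : Relations h1 δ s) (f : F) :
    Relations h1 δ (fun u v h => f (s u v h)) where
  star_eq u v h := by rw [← map_star, hs.star_eq]
  mul_eq u v w h h' := by rw [← map_mul, hs.mul_eq]
  sum_eq u v h j := by rw [hs.sum_eq u v h j, map_sum]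
  orthogonal u v hu hv huv := by rw [← map_mul, hs.orthogonal u v hu hv huv, map_zero]

end General

end Relations

/-- Pythagoras: `‖p x‖² = ∑ ‖q i x‖²`. So `p x = 0` forces every `q i x = 0`, which gives `q i ≤ p`;
and for `x` in the range of `q j` the `j`-th term already exhausts the sum, so the others vanish. -/
theorem orthogonal_of_sum_projections {H : Type*} [NormedAddCommGroup H] [InnerProductSpace ℂ H]
    [CompleteSpace H] {ι : Type*} [Fintype ι] {q : ι → H →L[ℂ] H} {p : H →L[ℂ] H}
    (hq : ∀ i, star (q i) = q i) (hqq : ∀ i, q i * q i = q i) (hp : star p = p) (hpp : p * p = p)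
    (hsum : p = ∑ i, q i) :
    (∀ i, q i * p = q i) ∧ (∀ i j, i ≠ j → q i * q j = 0) := by
  have norm_sq : ∀ e : H →L[ℂ] H, star e = e → e * e = e → ∀ x,
      ‖e x‖ ^ 2 = (inner ℂ (e x) x).re := fun e he hee x => by
    have h := ContinuousLinearMap.adjoint_inner_left e x (e x)
    rw [← ContinuousLinearMap.star_eq_adjoint, he] at h
    have h2 : e (e x) = e x := congrArg (fun T : H →L[ℂ] H => T x) hee
    rw [h2] at h
    rw [h, inner_self_eq_norm_sq_to_K]
    norm_cast
  have key : ∀ x, ‖p x‖ ^ 2 = ∑ i, ‖q i x‖ ^ 2 := fun x => by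
    rw [norm_sq p hp hpp, hsum]
    simp only [_root_.sum_apply, sum_inner, Complex.re_sum]
    exact Finset.sum_congr rfl fun i _ => (norm_sq _ (hq i) (hqq i) x).symm
  have hker : ∀ x, p x = 0 → ∀ i, q i x = 0 := fun x hx i => by
    have h := key x
    rw [hx, norm_zero, zero_pow two_ne_zero] at h
    have h2 := (Finset.sum_eq_zero_iff_of_nonneg (fun i _ => sq_nonneg _)).1 h.symm i
      (Finset.mem_univ i)
    simpa using h2
  have hqp : ∀ i, q i * p = q i := fun i => by
    ext x
    have h := hker (x - p x) (by
      have h2 : p (p x) = p x := congrArg (fun T : H →L[ℂ] H => T x) hpp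
      rw [map_sub, h2, sub_self]) i
    rw [map_sub, sub_eq_zero] at h
    exact h.symm
  have hpq : ∀ i, p * q i = q i := fun i => by
    have h := congrArg star (hqp i)
    rwa [star_mul, hp, hq] at h
  refine ⟨hqp, fun i j hij => ?_⟩
  ext y
  have h := key (q j y)
  have h2 : p (q j y) = q j y := congrArg (fun T : H →L[ℂ] H => T y) (hpq j)
  have h3 : q j (q j y) = q j y := congrArg (fun T : H →L[ℂ] H => T y) (hqq j)
  classical
  rw [h2, ← Finset.add_sum_erase _ _ (Finset.mem_univ j), h3, left_eq_add,
    Finset.sum_eq_zero_iff_of_nonneg (fun i _ => sq_nonneg _)] at h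
  simpa using h i (Finset.mem_erase.2 ⟨hij, Finset.mem_univ i⟩)

/-! ### Orthogonality of the projections `s_{u,u}` -/

namespace Relations

variable {H : Type*} [NormedAddCommGroup H] [InnerProductSpace ℂ H] [CompleteSpace H]
  {s : ∀ u v : DWord M δ, u.t = v.t → H →L[ℂ] H}

theorem sum_projections (hs : Relations h1 δ s) (u : DWord M δ) (n : Fin r → ℕ) :
    (∀ w : Words M n u.t, s (u.mul h1 w.1 w.2) (u.mul h1 w.1 w.2) rfl * s u u rfl =
      s (u.mul h1 w.1 w.2) (u.mul h1 w.1 w.2) rfl) ∧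
    (∀ w w' : Words M n u.t, w ≠ w' → s (u.mul h1 w.1 w.2) (u.mul h1 w.1 w.2) rfl *
      s (u.mul h1 w'.1 w'.2) (u.mul h1 w'.1 w'.2) rfl = 0) :=
  orthogonal_of_sum_projections
    (q := fun w : Words M n u.t => s (u.mul h1 w.1 w.2) (u.mul h1 w.1 w.2) rfl)
    (fun _ => hs.star_eq _ _ _) (fun _ => hs.mul_eq _ _ _ _ _) (hs.star_eq _ _ _)
    (hs.mul_eq _ _ _ _ _) (hs.sum_words n u u u.t rfl rfl)

/-- A decorated word extends the vertex of its decoration, so its projection is one of the summands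
of the vertex projection. -/
theorem mul_vertex (hs : Relations h1 δ s) (u : DWord M δ) :
    s u u rfl * s (.vertex M δ u.dec) (.vertex M δ u.dec) rfl = s u u rfl := by
  obtain ⟨h, hu⟩ := u.exists_eq_vertex_mul h1
  have h2 := (hs.sum_projections (.vertex M δ u.dec) u.shape).1 ⟨u.word, h⟩
  rwa [family_congr s hu hu rfl rfl] at h2

theorem vertex_mul (hs : Relations h1 δ s) (u : DWord M δ) :
    s (.vertex M δ u.dec) (.vertex M δ u.dec) rfl * s u u rfl = s u u rfl := by
  have h := congrArg star (hs.mul_vertex u)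
  rwa [star_mul, hs.star_eq, hs.star_eq] at h

theorem mul_eq_zero_of_dec_ne (hs : Relations h1 δ s) {u v : DWord M δ} (h : u.dec ≠ v.dec) :
    s u u rfl * s v v rfl = 0 := by
  have h0 := hs.orthogonal _ _ rfl rfl (fun h' : DWord.vertex M δ u.dec = .vertex M δ v.dec =>
    h (by have := congrArg DWord.dec h'; exact this))
  rw [← hs.mul_vertex u, ← hs.vertex_mul v, mul_assoc, ← mul_assoc (s (.vertex M δ u.dec) _ _),
    h0, zero_mul, mul_zero]

theorem mul_eq_zero_of_shape_eq (hs : Relations h1 δ s) {u v : DWord M δ}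
    (h : u.shape = v.shape) (huv : u ≠ v) : s u u rfl * s v v rfl = 0 := by
  by_cases hd : u.dec = v.dec
  · obtain ⟨n, d, w, hw⟩ := u
    obtain ⟨n', d', w', hw'⟩ := v
    obtain rfl : n = n' := h
    obtain rfl : d = d' := hd
    obtain ⟨h, hu⟩ := (DWord.mk n d w hw).exists_eq_vertex_mul h1
    obtain ⟨h', hu'⟩ := (DWord.mk n d w' hw').exists_eq_vertex_mul h1
    have h2 := (hs.sum_projections (.vertex M δ d) n).2 ⟨w, h⟩ ⟨w', h'⟩ (fun he => huv (by
      obtain rfl : w = w' := congrArg Subtype.val he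
      rfl))
    rwa [family_congr s hu hu rfl rfl, family_congr s hu' hu' rfl rfl] at h2
  · exact hs.mul_eq_zero_of_dec_ne hd

/-- Expand `u` by all words of shape `v.shape` and `v` by all words of shape `u.shape`. All terms
then have the same shape, where distinct words are orthogonal, and a coincidence would be a common
extension. -/
theorem mul_eq_zero_of_no_extension (hs : Relations h1 δ s) {u v : DWord M δ}
    (huv : ∀ (m n : Fin r → ℕ) (w : Word M m) (w' : Word M n) (h : w.o = u.t) (h' : w'.o = v.t),
      u.mul h1 w h ≠ v.mul h1 w' h') : s u u rfl * s v v rfl = 0 := by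
  rw [hs.sum_words v.shape u u u.t rfl rfl, hs.sum_words u.shape v v v.t rfl rfl,
    Finset.sum_mul_sum]
  refine Finset.sum_eq_zero fun w _ => Finset.sum_eq_zero fun w' _ => ?_
  exact hs.mul_eq_zero_of_shape_eq (add_comm _ _) (huv _ _ _ _ _ _)

theorem mul_mul_eq_zero (hs : Relations h1 δ s) {u v v' w : DWord M δ} (h : u.t = v.t)
    (h' : v'.t = w.t) (h0 : s v v rfl * s v' v' rfl = 0) : s u v h * s v' w h' = 0 := by
  rw [← hs.mul_eq u v v h rfl, ← hs.mul_eq v' v' w rfl h', mul_assoc,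
    ← mul_assoc (s v v rfl), h0, zero_mul, mul_zero]

end Relations

end Relations

/-! ### Homomorphisms between concretely generated algebras -/

section ClosedStarSpan

variable {B B' : Type*} [NonUnitalCStarAlgebra B] [NonUnitalCStarAlgebra B']

theorem isClosed_closedStarSpan (s : Set B) : IsClosed (closedStarSpan s : Set B) := inferInstance

theorem subset_closedStarSpan (s : Set B) : s ⊆ closedStarSpan s :=
  (NonUnitalStarAlgebra.subset_adjoin ℂ s).trans subset_closure

theorem closedStarSpan_le {s : Set B} {S : NonUnitalStarSubalgebra ℂ B} (hS : IsClosed (S : Set B))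
    (h : s ⊆ S) : closedStarSpan s ≤ S :=
  NonUnitalStarSubalgebra.topologicalClosure_minimal _ (NonUnitalStarAlgebra.adjoin_le h) hS

theorem continuous_starHom (f : B →⋆ₙₐ[ℂ] B') : Continuous f :=
  AddMonoidHomClass.continuous_of_bound f 1 fun x => by
    simpa using NonUnitalStarAlgHom.norm_apply_le f x

theorem map_mem_closedStarSpan (f : B →⋆ₙₐ[ℂ] B') {s : Set B} {t : Set B'}
    (h : ∀ x ∈ s, f x ∈ closedStarSpan t) {x : B} (hx : x ∈ closedStarSpan s) :
    f x ∈ closedStarSpan t := by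
  have hcl : IsClosed ((closedStarSpan t).comap f : Set B) :=
    (isClosed_closedStarSpan t).preimage (continuous_starHom f)
  exact closedStarSpan_le hcl h hx

/-- A `*`-homomorphism which maps `s` into the algebra generated by `t`, restricted to the algebra
generated by `s`. -/
def mapClosedStarSpan (f : B →⋆ₙₐ[ℂ] B') (s : Set B) (t : Set B')
    (h : ∀ x ∈ s, f x ∈ closedStarSpan t) : closedStarSpan s →⋆ₙₐ[ℂ] closedStarSpan t :=
  NonUnitalStarAlgHom.codRestrict
    (f.comp (NonUnitalStarSubalgebraClass.subtype (closedStarSpan s)))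
    (closedStarSpan t) fun x => map_mem_closedStarSpan f h x.2

/-- The generated algebra is closed in `B`, so `S`, closed in it, has closed image in `B`, and
minimality applies to that image. -/
theorem closedStarSpan_induction {s : Set B} {S : NonUnitalStarSubalgebra ℂ (closedStarSpan s)}
    (hS : IsClosed (S : Set (closedStarSpan s)))
    (h : ∀ x (hx : x ∈ s), (⟨x, subset_closedStarSpan s hx⟩ : closedStarSpan s) ∈ S)
    (x : closedStarSpan s) : x ∈ S := by
  have hcl : IsClosed (S.map (NonUnitalStarSubalgebraClass.subtype (closedStarSpan s)) : Set B) :=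
    (isClosed_closedStarSpan s).isClosedEmbedding_subtypeVal.isClosedMap _ hS
  obtain ⟨y, hy, hyx⟩ := closedStarSpan_le hcl (fun x hx => ⟨_, h x hx, rfl⟩) x.2
  rwa [← (Subtype.ext hyx : y = x)]

theorem closedStarSpan_hom_ext {s : Set B} {f g : closedStarSpan s →⋆ₙₐ[ℂ] B'}
    (h : ∀ x (hx : x ∈ s), f ⟨x, subset_closedStarSpan s hx⟩ = g ⟨x, subset_closedStarSpan s hx⟩) :
    f = g := by
  ext x
  have hcl : IsClosed (NonUnitalStarAlgHom.equalizer f g : Set (closedStarSpan s)) :=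
    isClosed_eq (continuous_starHom f) (continuous_starHom g)
  exact closedStarSpan_induction hcl h x

/-- The `*`-homomorphism between products of `C*`-algebras induced by a map of index sets. -/
def lpReindex {I J : Type*} (E : J → Type*) [∀ j, NonUnitalCStarAlgebra (E j)] (F : I → J) :
    lp E ∞ →⋆ₙₐ[ℂ] lp (fun i => E (F i)) ∞ where
  toFun x := ⟨fun i => x (F i), by
    obtain ⟨C, hC⟩ := memℓp_infty_iff.1 x.2
    exact memℓp_infty ⟨C, by rintro _ ⟨i, rfl⟩; exact hC ⟨F i, rfl⟩⟩⟩
  map_smul' _ _ := rfl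
  map_zero' := rfl
  map_add' _ _ := rfl
  map_mul' _ _ := rfl
  map_star' _ := rfl

/-- Evaluation of a bounded family at an index. -/
def lpEval {J : Type*} (E : J → Type*) [∀ j, NonUnitalCStarAlgebra (E j)] (j : J) :
    lp E ∞ →⋆ₙₐ[ℂ] E j where
  toFun x := x j
  map_smul' _ _ := rfl
  map_zero' := rfl
  map_add' _ _ := rfl
  map_mul' _ _ := rfl
  map_star' _ := rfl

end ClosedStarSpan

/-- The `C*`-algebra generated by a set of bounded families of operators. -/
def OperatorAlgebra {I : Type*} {K : I → Hilb} (t : Set (lp (fun i => (K i).B) ∞)) : Type _ :=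
  closedStarSpan t

instance {I : Type*} {K : I → Hilb} (t : Set (lp (fun i => (K i).B) ∞)) :
    NonUnitalCStarAlgebra (OperatorAlgebra t) :=
  inferInstanceAs (NonUnitalCStarAlgebra (closedStarSpan t))

/-- The projection to an index, a representation of the algebra. -/
def OperatorAlgebra.eval {I : Type*} {K : I → Hilb} (t : Set (lp (fun i => (K i).B) ∞)) (i : I) :
    OperatorAlgebra t →⋆ₙₐ[ℂ] (K i).B :=
  (lpEval (fun i => (K i).B) i).comp (NonUnitalStarSubalgebraClass.subtype (closedStarSpan t))

/-! ### The universal property of `𝒜_D` -/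

section Universal

variable {r : ℕ} {A : Type u} [Finite A] {M : Fin r → Matrix A A ℕ} {D : Type v}
  (h1 : UniqueProducts M) (δ : D → A)

namespace TilingAlgebra

/-- The generator `s_{u,v}` of `𝒜_D`. -/
def s (u v : DWord M δ) (h : u.t = v.t) : TilingAlgebra h1 δ :=
  ⟨gen h1 δ u v h, subset_closedStarSpan _ ⟨u, v, h, rfl⟩⟩

variable {h1 δ}

/-- The representation of `𝒜_D` given by operators which satisfy the relations. -/
def eval (ρ : Rep h1 δ) : TilingAlgebra h1 δ →⋆ₙₐ[ℂ] ρ.H.B :=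
  (lpEval (fun ρ : Rep h1 δ => ρ.H.B) ρ).comp
    (NonUnitalStarSubalgebraClass.subtype (closedStarSpan {x | ∃ u v h, x = gen h1 δ u v h}))

theorem norm_le_of_eval {x : TilingAlgebra h1 δ} {C : ℝ} (hC : 0 ≤ C)
    (h : ∀ ρ, ‖eval ρ x‖ ≤ C) : ‖x‖ ≤ C :=
  lp.norm_le_of_forall_le hC h

theorem ext_eval {x y : TilingAlgebra h1 δ} (h : ∀ ρ, eval ρ x = eval ρ y) : x = y :=
  Subtype.ext (lp.ext (funext h))

theorem induction {S : NonUnitalStarSubalgebra ℂ (TilingAlgebra h1 δ)}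
    (hS : IsClosed (S : Set (TilingAlgebra h1 δ))) (h : ∀ u v h, s h1 δ u v h ∈ S)
    (x : TilingAlgebra h1 δ) : x ∈ S :=
  closedStarSpan_induction (s := {x | ∃ u v h, x = gen h1 δ u v h}) hS
    (by rintro _ ⟨u, v, huv, rfl⟩; exact h u v huv) x

theorem hom_ext {B : Type*} [NonUnitalCStarAlgebra B] {f g : TilingAlgebra h1 δ →⋆ₙₐ[ℂ] B}
    (h : ∀ u v h, f (s h1 δ u v h) = g (s h1 δ u v h)) : f = g :=
  closedStarSpan_hom_ext (s := {x | ∃ u v h, x = gen h1 δ u v h})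
    (by rintro _ ⟨u, v, huv, rfl⟩; exact h u v huv)

/-- A family of elements of a concrete `C*`-algebra of operators which satisfies the relations
defines a homomorphism on `𝒜_D`. -/
def lift {I : Type*} {K : I → Hilb} (t : Set (lp (fun i => (K i).B) ∞))
    (x : ∀ u v : DWord M δ, u.t = v.t → OperatorAlgebra t)
    (rel : ∀ i, Relations h1 δ (fun u v h => OperatorAlgebra.eval t i (x u v h))) :
    TilingAlgebra h1 δ →⋆ₙₐ[ℂ] OperatorAlgebra t :=
  -- Each index `i` yields a representation of the relations, hence an index of the universal
  -- product. Restricting bounded families along this map sends `gen` to `x`.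
  mapClosedStarSpan (lpReindex (fun ρ : Rep h1 δ => ρ.H.B)
      (fun i => (⟨K i, fun u v h => OperatorAlgebra.eval t i (x u v h), rel i⟩ : Rep h1 δ)))
    {x | ∃ u v h, x = gen h1 δ u v h} t (by
      rintro _ ⟨u, v, h, rfl⟩
      exact (x u v h).2)

theorem relations : Relations h1 δ (s h1 δ) where
  star_eq u v h := ext_eval fun ρ => by
    rw [map_star]; exact ρ.rel.star_eq u v h
  mul_eq u v w h h' := ext_eval fun ρ => by
    rw [map_mul]; exact ρ.rel.mul_eq u v w h h'
  sum_eq u v h j := ext_eval fun ρ => by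
    rw [map_sum]; exact ρ.rel.sum_eq u v h j
  orthogonal u v hu hv huv := ext_eval fun ρ => by
    rw [map_mul, map_zero]; exact ρ.rel.orthogonal u v hu hv huv

end TilingAlgebra

end Universal

/-! ### Change of decoration -/

section ChangeOfDecoration

variable {r : ℕ} {A : Type u} {M : Fin r → Matrix A A ℕ} {D : Type v} {D' : Type*}

/-- A map between decorated words which is compatible with right multiplication, and which is
bijective over the decorated words of large shape. -/
structure Refinement (h1 : UniqueProducts M) (δ' : D' → A) (δ : D → A) where
  toFun : DWord M δ' → DWord M δ
  t_eq : ∀ u, (toFun u).t = u.t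
  map_mul : ∀ (u : DWord M δ') (n : Fin r → ℕ) (w : Word M n) (h : w.o = u.t),
    toFun (u.mul h1 w h) = (toFun u).mul h1 w (h.trans (t_eq u).symm)
  bound : Fin r → ℕ
  existsUnique : ∀ u : DWord M δ, bound ≤ u.shape → ∃! u', toFun u' = u

namespace Refinement

variable {h1 : UniqueProducts M} {δ' : D' → A} {δ : D → A} (c : Refinement h1 δ' δ)

/-- The preimage of a decorated word of large shape. -/
def pre (u : DWord M δ) (hu : c.bound ≤ u.shape) : DWord M δ' := (c.existsUnique u hu).choose

theorem toFun_pre (u : DWord M δ) (hu : c.bound ≤ u.shape) : c.toFun (c.pre u hu) = u :=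
  (c.existsUnique u hu).choose_spec.1

theorem pre_eq {u : DWord M δ} (hu : c.bound ≤ u.shape) {u' : DWord M δ'} (h : c.toFun u' = u) :
    c.pre u hu = u' :=
  (c.existsUnique u hu).unique (c.toFun_pre u hu) h

theorem eq_of_toFun_eq {u v : DWord M δ'} (hu : c.bound ≤ (c.toFun u).shape)
    (h : c.toFun u = c.toFun v) : u = v :=
  (c.existsUnique _ hu).unique rfl h.symm

theorem pre_t (u : DWord M δ) (hu : c.bound ≤ u.shape) : (c.pre u hu).t = u.t := by
  rw [← c.t_eq, c.toFun_pre]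

theorem pre_congr {u v : DWord M δ} (h : u = v) (hu : c.bound ≤ u.shape)
    (hv : c.bound ≤ v.shape) : c.pre u hu = c.pre v hv := by
  subst h; rfl

theorem mul_eq_mul_of_pre {u v : DWord M δ} (hu : c.bound ≤ u.shape) (hv : c.bound ≤ v.shape)
    {m n : Fin r → ℕ} {w : Word M m} {w' : Word M n} {h : w.o = (c.pre u hu).t}
    {h' : w'.o = (c.pre v hv).t}
    (he : (c.pre u hu).mul h1 w h = (c.pre v hv).mul h1 w' h') :
    u.mul h1 w (h.trans (c.pre_t u hu)) = v.mul h1 w' (h'.trans (c.pre_t v hv)) := by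
  have := congrArg c.toFun he
  rw [c.map_mul, c.map_mul] at this
  refine Eq.trans ?_ (this.trans ?_)
  · exact DWord.mul_congr h1 (c.toFun_pre u hu).symm rfl _ _
  · exact DWord.mul_congr h1 (c.toFun_pre v hv) rfl _ _

/-- A decorated word extended by a word of shape `bound`, seen as a word with the finer
decoration. -/
def extend (u : DWord M δ) {a : A} (hu : u.t = a) (w : Words M c.bound a) : DWord M δ' :=
  c.pre (u.mul h1 w.1 (w.2.trans hu.symm)) (le_add_of_nonneg_left (fun _ => Nat.zero_le _))

theorem extend_t (u : DWord M δ) {a : A} (hu : u.t = a) (w : Words M c.bound a) :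
    (c.extend u hu w).t = w.1.t :=
  (c.pre_t _ _).trans (u.mul_t h1 _ _)

theorem toFun_extend (u : DWord M δ) {a : A} (hu : u.t = a) (w : Words M c.bound a) :
    c.toFun (c.extend u hu w) = u.mul h1 w.1 (w.2.trans hu.symm) :=
  c.toFun_pre _ _

theorem extend_toFun (u : DWord M δ') {a : A} (hu : (c.toFun u).t = a) (w : Words M c.bound a) :
    c.extend (c.toFun u) hu w = u.mul h1 w.1 ((w.2.trans hu.symm).trans (c.t_eq u)) :=
  c.pre_eq _ (c.map_mul _ _ _ _)

/-- A common extension upstairs is carried by `c.toFun` to a common extension of `uw` and `vw'`, so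
its absence can be tested among the coarse words. -/
theorem extend_mul_ne {u v : DWord M δ} {a b : A} (hu : u.t = a) (hv : v.t = b)
    {w : Words M c.bound a} {w' : Words M c.bound b}
    (hne : ∀ (m n : Fin r → ℕ) (x : Word M m) (y : Word M n) (hx : w.1.t = x.o) (hy : w'.1.t = y.o),
      u.mul h1 (w.1.mul h1 x hx) ((Word.mul_o _ _ _ _).trans (w.2.trans hu.symm)) ≠
        v.mul h1 (w'.1.mul h1 y hy) ((Word.mul_o _ _ _ _).trans (w'.2.trans hv.symm)))
    (m n : Fin r → ℕ) (x : Word M m) (y : Word M n) (hx : x.o = (c.extend u hu w).t)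
    (hy : y.o = (c.extend v hv w').t) :
    (c.extend u hu w).mul h1 x hx ≠ (c.extend v hv w').mul h1 y hy := fun he => by
  have h2 := c.mul_eq_mul_of_pre _ _ he
  rw [DWord.mul_mul _ _ _ _ _ (hx.trans (c.extend_t u hu w)).symm,
    DWord.mul_mul _ _ _ _ _ (hy.trans (c.extend_t v hv w')).symm] at h2
  exact hne _ _ _ _ _ _ h2

variable [Finite A]

/-- The family on the coarser decorated words determined by a family on the finer ones. -/
def family {B : Type*} [AddCommMonoid B] (s : ∀ u v : DWord M δ', u.t = v.t → B)
    (u v : DWord M δ) (h : u.t = v.t) : B :=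
  ∑ w : Words M c.bound u.t, s (c.extend u rfl w) (c.extend v h.symm w)
    ((c.extend_t _ _ _).trans (c.extend_t _ _ _).symm)

theorem family_eq {B : Type*} [AddCommMonoid B] (s : ∀ u v : DWord M δ', u.t = v.t → B)
    (u v : DWord M δ) (a : A) (hu : u.t = a) (hv : v.t = a) :
    c.family s u v (hu.trans hv.symm) = ∑ w : Words M c.bound a,
      s (c.extend u hu w) (c.extend v hv w) ((c.extend_t _ _ _).trans (c.extend_t _ _ _).symm) := by
  subst hu; rfl

variable {H : Type*} [NormedAddCommGroup H] [InnerProductSpace ℂ H] [CompleteSpace H]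

/-- In products, the terms with different `w` of shape `bound` vanish for lack of a common
extension. For the sum relation, both sides are sums over words of shape `bound + e_j`, cut in the
two possible orders. -/
theorem relations_family {s : ∀ u v : DWord M δ', u.t = v.t → H →L[ℂ] H}
    (hs : Relations h1 δ' s) : Relations h1 δ (c.family s) where
  star_eq u v h := by
    rw [c.family_eq s u v u.t rfl h.symm, c.family_eq s v u u.t h.symm rfl, star_sum]
    exact Finset.sum_congr rfl fun w _ => hs.star_eq _ _ _
  mul_eq u v x h h' := by
    rw [c.family_eq s u v u.t rfl h.symm, c.family_eq s v x u.t h.symm (h'.symm.trans h.symm),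
      c.family_eq s u x u.t rfl (h'.symm.trans h.symm), Finset.sum_mul_sum]
    refine Finset.sum_congr rfl fun w _ => ?_
    rw [Finset.sum_eq_single_of_mem w (Finset.mem_univ _), hs.mul_eq]
    intro w' _ hw'
    refine hs.mul_mul_eq_zero _ _ (hs.mul_eq_zero_of_no_extension ?_)
    refine c.extend_mul_ne _ _ fun m n y z hy hz he => hw' (Subtype.ext ?_)
    rw [← DWord.mul_mul _ _ _ _ (w.2.trans h) , ← DWord.mul_mul _ _ _ _ (w'.2.trans h)] at he
    have he' := DWord.eq_of_mul_eq_mul h1 (by rfl) he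
    exact (DWord.mul_left_cancel h1 he').symm
  sum_eq u v h j := by
    have hle : ∀ {w : DWord M δ} {p : Fin r → ℕ} (x : Word M p) (hx : x.o = w.t),
        c.bound ≤ p → c.bound ≤ (w.mul h1 x hx).shape :=
      fun _ _ hp => hp.trans (le_add_of_nonneg_left (fun _ => Nat.zero_le _))
    -- Taking an arbitrary shape `p ≥ bound` lets `bound + e_j` and `e_j + bound` be exchanged by
    -- substitution, without transporting words.
    let G : ∀ p, c.bound ≤ p → Words M p u.t → H →L[ℂ] H := fun p hp y =>
      s (c.pre (u.mul h1 y.1 y.2) (hle _ _ hp)) (c.pre (v.mul h1 y.1 (y.2.trans h)) (hle _ _ hp))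
        (by rw [c.pre_t, c.pre_t, DWord.mul_t, DWord.mul_t])
    have hG : ∀ p q (hp : c.bound ≤ p) (hq : c.bound ≤ q), p = q →
        ∑ y, G p hp y = ∑ y, G q hq y := by
      rintro p _ _ _ rfl; rfl
    have hl := hG (c.bound + Pi.single j 1) (Pi.single j 1 + c.bound)
      (le_add_of_nonneg_right (fun _ => Nat.zero_le _))
      (le_add_of_nonneg_left (fun _ => Nat.zero_le _)) (add_comm _ _)
    rw [sum_words_add h1, sum_words_add h1] at hl
    refine Eq.trans ?_ (hl.trans ?_)
    · rw [c.family_eq s u v u.t rfl h.symm]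
      refine Finset.sum_congr rfl fun w _ => ?_
      rw [hs.sum_edges j _ _ w.1.t (c.extend_t _ _ _) (c.extend_t _ _ _)]
      refine Finset.sum_congr rfl fun e _ => family_congr s ?_ ?_ _ _
      · refine c.pre_eq _ ?_ |>.symm
        rw [c.map_mul]
        refine Eq.trans (DWord.mul_congr h1 (c.toFun_extend u rfl w) rfl _ ?_)
          (DWord.mul_mul h1 u w.1 e.1 w.2 e.2.symm)
        rw [DWord.mul_t, e.2]
      · refine c.pre_eq _ ?_ |>.symm
        rw [c.map_mul]
        refine Eq.trans (DWord.mul_congr h1 (c.toFun_extend v h.symm w) rfl _ ?_)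
          (DWord.mul_mul h1 v w.1 e.1 (w.2.trans h) e.2.symm)
        rw [DWord.mul_t, e.2]
    · refine Finset.sum_congr rfl fun w _ => ?_
      rw [c.family_eq s _ _ w.1.t (u.mul_t h1 _ _) (v.mul_t h1 _ _)]
      refine Finset.sum_congr rfl fun x _ => family_congr s ?_ ?_ _ _
      · exact c.pre_congr (DWord.mul_mul h1 u w.1 x.1 w.2 x.2.symm).symm _ _
      · exact c.pre_congr (DWord.mul_mul h1 v w.1 x.1 (w.2.trans h) x.2.symm).symm _ _
  orthogonal u v hu hv huv := by
    rw [c.family_eq s u u u.t rfl rfl, c.family_eq s v v v.t rfl rfl, Finset.sum_mul_sum]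
    refine Finset.sum_eq_zero fun w _ => Finset.sum_eq_zero fun w' _ => ?_
    refine hs.mul_eq_zero_of_no_extension ?_
    refine c.extend_mul_ne _ _ fun m n y z hy hz he => huv ?_
    exact DWord.eq_of_mul_eq_mul h1 (hu.trans hv.symm) he

theorem relations_comp {s : ∀ u v : DWord M δ, u.t = v.t → H →L[ℂ] H}
    (hs : Relations h1 δ s) : Relations h1 δ' (fun u v h =>
      s (c.toFun u) (c.toFun v) (((c.t_eq u).trans h).trans (c.t_eq v).symm)) where
  star_eq u v h := hs.star_eq _ _ _
  mul_eq u v x h h' := hs.mul_eq _ _ _ _ _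
  sum_eq u v h j := by
    rw [hs.sum_edges j _ _ u.t (c.t_eq u) ((c.t_eq v).trans h.symm)]
    refine Finset.sum_congr rfl fun w _ => ?_
    exact family_congr s (c.map_mul _ _ _ _).symm (c.map_mul _ _ _ _).symm _ _
  orthogonal u v hu hv huv := by
    -- The images of words of shape `0` may have different shapes, and `c.toFun` is injective only
    -- above `bound`; both factors are therefore extended by `bound` first.
    rw [hs.sum_words c.bound _ _ u.t (c.t_eq u) (c.t_eq u),
      hs.sum_words c.bound _ _ v.t (c.t_eq v) (c.t_eq v), Finset.sum_mul_sum]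
    refine Finset.sum_eq_zero fun w _ => Finset.sum_eq_zero fun w' _ => ?_
    refine hs.mul_eq_zero_of_no_extension fun m n x y hx hy he => huv ?_
    have hx' : w.1.t = x.o := (hx.trans (DWord.mul_t _ _ _ _)).symm
    have hy' : w'.1.t = y.o := (hy.trans (DWord.mul_t _ _ _ _)).symm
    rw [DWord.mul_mul _ _ _ _ _ hx', DWord.mul_mul _ _ _ _ _ hy',
      ← c.map_mul _ _ _ ((Word.mul_o _ _ _ _).trans w.2),
      ← c.map_mul _ _ _ ((Word.mul_o _ _ _ _).trans w'.2)] at he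
    refine DWord.eq_of_mul_eq_mul h1 (hu.trans hv.symm) (c.eq_of_toFun_eq ?_ he)
    rw [c.map_mul]
    exact (le_add_of_nonneg_right (fun _ => Nat.zero_le _)).trans
      (le_add_of_nonneg_left (fun _ => Nat.zero_le _))

open TilingAlgebra in
/-- The homomorphism `𝒜_{D'} → 𝒜_D` given by a refinement of decorations. -/
def hom : TilingAlgebra h1 δ' →⋆ₙₐ[ℂ] TilingAlgebra h1 δ :=
  lift (K := fun ρ : Rep h1 δ => ρ.H) {x | ∃ u v h, x = gen h1 δ u v h}
    (fun u v h => s h1 δ (c.toFun u) (c.toFun v) (((c.t_eq u).trans h).trans (c.t_eq v).symm))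
    (fun ρ => c.relations_comp ρ.rel)

open TilingAlgebra in
theorem hom_s (u v : DWord M δ') (h : u.t = v.t) : c.hom (s h1 δ' u v h) =
    s h1 δ (c.toFun u) (c.toFun v) (((c.t_eq u).trans h).trans (c.t_eq v).symm) := rfl

open TilingAlgebra in
theorem eval_family (ρ : Rep h1 δ') (u v : DWord M δ) (h : u.t = v.t) :
    eval ρ (c.family (s h1 δ') u v h) = c.family ρ.S u v h :=
  map_sum _ _ _

open TilingAlgebra in
/-- The homomorphism `𝒜_D → 𝒜_{D'}` given by a refinement of decorations. -/
def invHom : TilingAlgebra h1 δ →⋆ₙₐ[ℂ] TilingAlgebra h1 δ' :=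
  lift (K := fun ρ : Rep h1 δ' => ρ.H) {x | ∃ u v h, x = gen h1 δ' u v h}
    (fun u v h => c.family (s h1 δ') u v h)
    (fun ρ => by
      have : (fun u v h => eval ρ (c.family (s h1 δ') u v h)) = c.family ρ.S := by
        funext u v h; exact c.eval_family ρ u v h
      exact this ▸ c.relations_family ρ.rel)

open TilingAlgebra in
theorem invHom_s (u v : DWord M δ) (h : u.t = v.t) :
    c.invHom (s h1 δ u v h) = c.family (s h1 δ') u v h := rfl

open TilingAlgebra in
-- On `s_{u,v}` the composite is `∑ s_{uw,vw}` over the words `w` of shape `bound`, which is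
-- `s_{u,v}` by the iterated sum relation.
theorem invHom_comp_hom : c.invHom.comp c.hom = NonUnitalStarAlgHom.id ℂ _ := by
  refine hom_ext fun u v h => ?_
  rw [NonUnitalStarAlgHom.comp_apply, hom_s, invHom_s, NonUnitalStarAlgHom.coe_id, id,
    c.family_eq _ _ _ u.t (c.t_eq u) ((c.t_eq v).trans h.symm),
    relations.sum_words c.bound u v u.t rfl h.symm]
  exact Finset.sum_congr rfl fun w _ => family_congr _ (c.extend_toFun _ _ _)
    (c.extend_toFun _ _ _) _ _

open TilingAlgebra in
theorem hom_comp_invHom : c.hom.comp c.invHom = NonUnitalStarAlgHom.id ℂ _ := by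
  refine hom_ext fun u v h => ?_
  rw [NonUnitalStarAlgHom.comp_apply, invHom_s, NonUnitalStarAlgHom.coe_id, id,
    c.family_eq _ u v u.t rfl h.symm, map_sum, relations.sum_words c.bound u v u.t rfl h.symm]
  refine Finset.sum_congr rfl fun w _ => (c.hom_s _ _ _).trans ?_
  exact family_congr _ (c.toFun_extend _ _ _)
    (c.toFun_extend _ _ _) _ _

/-- A refinement of decorations induces an isomorphism. -/
def equiv : TilingAlgebra h1 δ' ≃⋆ₐ[ℂ] TilingAlgebra h1 δ :=
  { c.hom with
    invFun := c.invHom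
    left_inv := fun x => DFunLike.congr_fun c.invHom_comp_hom x
    right_inv := fun x => DFunLike.congr_fun c.hom_comp_invHom x }

end Refinement

end ChangeOfDecoration

/-! ### Infinitely many decorations of each type -/

section InfiniteDecorations

variable {r : ℕ} {A : Type u} {M : Fin r → Matrix A A ℕ} {D : Type v} {D' : Type*}

/-- The decorated words of which the shape is a given function of the decoration. -/
abbrev Cells (M : Fin r → Matrix A A ℕ) (δ : D → A) (m : D → Fin r → ℕ) : Type (max u v) :=
  Σ d : D, Words M (m d) (δ d)

/-- A cell, as a decorated word. -/
def Cells.toDWord {δ : D → A} {m : D → Fin r → ℕ} (x : Cells M δ m) : DWord M δ :=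
  ⟨m x.1, x.1, x.2.1, x.2.2⟩

theorem Cells.toDWord_injective {δ : D → A} {m : D → Fin r → ℕ} :
    Function.Injective (Cells.toDWord : Cells M δ m → DWord M δ) := by
  rintro ⟨d, w, hw⟩ ⟨d', w', hw'⟩ h
  obtain rfl : d = d' := congrArg DWord.dec h
  have : w = w' := Word.ext_apply fun l => DWord.apply_congr h l.1 l.2 l.2
  subst this
  rfl

/-- The subdivision of each decoration into the words of a bounded shape is a refinement. -/
def Refinement.ofCells (h1 : UniqueProducts M) {δ' : D' → A} {δ : D → A} {m : D → Fin r → ℕ}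
    (N : Fin r → ℕ) (hN : ∀ d, m d ≤ N) (e : D' ≃ Cells M δ m)
    (he : ∀ d, (e d).toDWord.t = δ' d) : Refinement h1 δ' δ where
  toFun u := (e u.dec).toDWord.mul h1 u.word (u.o_eq.trans (he _).symm)
  t_eq u := DWord.mul_t _ _ _ _
  map_mul u n w h := (DWord.mul_mul h1 (e u.dec).toDWord u.word w
    (u.o_eq.trans (he _).symm) h.symm).symm
  bound := N
  existsUnique u hu := by
    -- The bound makes `u` long enough to have an initial segment of shape `m u.dec`, which is a
    -- cell; the remainder `w` is the word of the preimage.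
    obtain ⟨v, n, w, h, hv, hvu⟩ := u.exists_eq_mul h1 ((hN u.dec).trans hu)
    have hd : v.dec = u.dec := by rw [← hvu]; rfl
    rw [← hd] at hv
    obtain ⟨x, hx⟩ : ∃ x : Cells M δ m, x.toDWord = v := by
      obtain ⟨p, d, y, hy⟩ := v
      obtain rfl : p = m d := hv
      exact ⟨⟨d, y, hy⟩, rfl⟩
    obtain ⟨d', rfl⟩ := e.surjective x
    subst hx
    refine ⟨⟨n, d', w, h.trans (he d')⟩, hvu, ?_⟩
    rintro ⟨n', d'', w', hw'⟩ hu'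
    have h2 : (e d'').toDWord.mul h1 w' (hw'.trans (he _).symm) = (e d').toDWord.mul h1 w h :=
      hu'.trans hvu.symm
    have hdec : (e d'').1 = (e d').1 := by have := congrArg DWord.dec h2; exact this
    have hs : (e d'').toDWord.shape = (e d').toDWord.shape := congrArg m hdec
    have h3 := e.injective (Cells.toDWord_injective (DWord.eq_of_mul_eq_mul h1 hs h2))
    subst h3
    obtain rfl : n' = n := by have := congrArg DWord.shape h2; exact add_left_cancel this
    obtain rfl := DWord.mul_left_cancel h1 h2
    rfl

/-! ### Connecting words and infinite fibres over the alphabet -/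

theorem exists_edge {j : Fin r} {a b : A} (h : M j b a = 1) :
    ∃ w : Word M (Pi.single j 1), w.o = a ∧ w.t = b := by
  classical
  refine ⟨⟨fun l => if l.1 = 0 then a else b, fun i l hl hl' => ?_⟩, ?_, ?_⟩
  · have hi : i = j := by
      by_contra hij
      have := hl' i
      simp [hij] at this
    subst hi
    have h0 : l = 0 := by
      funext k
      have := hl' k
      by_cases hk : k = i
      · subst hk; simp at this; simpa using this
      · simpa [hk] using this
    subst h0
    simpa using h
  · simp [Word.o]
  · simp [Word.t]

theorem exists_word (h1 : UniqueProducts M) {a b : A}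
    (h : Relation.ReflTransGen (fun a b => ∃ i, M i b a = 1) a b) :
    ∃ (m : Fin r → ℕ) (w : Word M m), w.o = a ∧ w.t = b := by
  induction h with
  | refl => exact ⟨0, (default : Words M 0 a).1, rfl, rfl⟩
  | tail _ hbc ih =>
    obtain ⟨m, w, rfl, rfl⟩ := ih
    obtain ⟨i, hi⟩ := hbc
    obtain ⟨e, he, rfl⟩ := exists_edge hi
    exact ⟨_, w.mul h1 e he.symm, Word.mul_o _ _ _ _, Word.mul_t _ _ _ _⟩

theorem exists_equiv_of_infinite_fibers {X : Type*} [Countable X] (f : X → A)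
    (hf : ∀ a, Infinite {x // f x = a}) : ∃ e : A × ℕ ≃ X, ∀ p, f (e p) = p.1 := by
  have h : ∀ a, Nonempty (ℕ ≃ {x // f x = a}) := fun a => by
    have := hf a
    obtain ⟨_⟩ := nonempty_denumerable {x // f x = a}
    exact ⟨(Denumerable.eqv _).symm⟩
  let g := fun a => (h a).some
  refine ⟨(Equiv.sigmaEquivProd A ℕ).symm.trans ((Equiv.sigmaCongrRight g).trans
    (Equiv.sigmaFiberEquiv f)), fun p => ?_⟩
  exact (g p.1 p.2).2

/-- Irreducibility joins `δ d₀` to each letter `a` by a word of some shape `m a`. If each shape `m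
a` is used for infinitely many copies of `d₀`, infinitely many cells end at `a`. -/
theorem exists_refinement [Finite A] (h1 : UniqueProducts M)
    (hirr : ∀ a b : A, Relation.ReflTransGen (fun a b => ∃ i, M i b a = 1) a b)
    [Countable D] [Nonempty D] (δ : D → A) :
    Nonempty (Refinement h1 (Prod.fst : A × ℕ → A) (fun p : D × ℕ => δ p.1)) := by
  obtain ⟨d₀⟩ := ‹Nonempty D›
  have : Fintype A := Fintype.ofFinite A
  have : Nonempty A := ⟨δ d₀⟩
  choose m w ho ht using fun a => exists_word h1 (hirr (δ d₀) a)
  obtain ⟨f, hf⟩ := exists_surjective_nat A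
  -- Unpairing the copy number makes every letter `f i` occur for the infinitely many copies
  -- `Nat.pair i k`.
  let mm : D × ℕ → Fin r → ℕ := fun p => m (f p.2.unpair.1)
  let X := Cells M (fun p : D × ℕ => δ p.1) mm
  have hinf : ∀ a, Infinite {x : X // x.toDWord.t = a} := fun a => by
    obtain ⟨i, rfl⟩ := hf a
    have key : ∀ k, ∃ x : X, x.toDWord.t = f i ∧ x.1.2 = Nat.pair i k := fun k => by
      obtain ⟨w', ho', ht'⟩ : ∃ w' : Word M (mm (d₀, Nat.pair i k)), w'.o = δ d₀ ∧ w'.t = f i := by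
        have hm : mm (d₀, Nat.pair i k) = m (f i) := by simp [mm]
        rw [hm]
        exact ⟨w (f i), ho _, ht _⟩
      exact ⟨⟨(d₀, Nat.pair i k), w', ho'⟩, ht', rfl⟩
    choose x hx hx' using key
    refine Infinite.of_injective (fun k => (⟨x k, hx k⟩ : {x : X // x.toDWord.t = f i})) ?_
    intro k k' hk
    have h2 : x k = x k' := congrArg Subtype.val hk
    have h3 := hx' k'
    rw [← h2, hx' k] at h3
    exact (Nat.pair_eq_pair.1 h3).2
  obtain ⟨e, he⟩ := exists_equiv_of_infinite_fibers (fun x : X => x.toDWord.t) hinf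
  -- As `A` is finite, the sum of all the shapes `m a` bounds each of them.
  refine ⟨Refinement.ofCells h1 (∑ a, m a) (fun p => ?_) e he⟩
  exact Finset.single_le_sum (f := m) (fun _ _ _ => Nat.zero_le _) (Finset.mem_univ _)

end InfiniteDecorations

/-! ### Matrix units and compact operators -/

section MatrixUnits

/-- The standard basis of `ℓ²(ℕ)`. -/
def stdBasis : HilbertBasis ℕ ℂ EllTwo := HilbertBasis.ofRepr (LinearIsometryEquiv.refl ℂ _)

/-- The matrix unit `e_{ij}`. -/
def matrixUnit (i j : ℕ) : EllTwo →L[ℂ] EllTwo :=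
  InnerProductSpace.rankOne ℂ (stdBasis i) (stdBasis j)

theorem star_matrixUnit (i j : ℕ) : star (matrixUnit i j) = matrixUnit j i := by
  rw [ContinuousLinearMap.star_eq_adjoint, matrixUnit, InnerProductSpace.adjoint_rankOne]; rfl

theorem matrixUnit_apply (i j k : ℕ) :
    matrixUnit i j (stdBasis k) = if j = k then stdBasis i else 0 := by
  rw [matrixUnit, InnerProductSpace.rankOne_apply,
    orthonormal_iff_ite.1 stdBasis.orthonormal, ite_smul, one_smul, zero_smul]

theorem matrixUnit_mul (i j k : ℕ) : matrixUnit i j * matrixUnit j k = matrixUnit i k := by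
  ext1 x
  change matrixUnit i j (matrixUnit j k x) = matrixUnit i k x
  conv_lhs => rw [matrixUnit.eq_def j k, InnerProductSpace.rankOne_apply, map_smul,
    matrixUnit_apply, if_pos rfl]
  rfl

theorem matrixUnit_mul_of_ne (i : ℕ) {j j' : ℕ} (h : j ≠ j') (l : ℕ) :
    matrixUnit i j * matrixUnit j' l = 0 := by
  ext1 x
  change matrixUnit i j (matrixUnit j' l x) = 0
  rw [matrixUnit.eq_def j' l, InnerProductSpace.rankOne_apply, map_smul,
    matrixUnit_apply, if_neg h, smul_zero]

theorem matrixUnit_mem (i j : ℕ) : matrixUnit i j ∈ compacts := by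
  change IsCompactOperator (matrixUnit i j)
  rw [matrixUnit, InnerProductSpace.rankOne_def']
  exact (isCompactOperator_of_locallyCompactSpace_rng
    (ContinuousLinearMap.toSpanSingleton ℂ (stdBasis i))).comp_clm (innerSL ℂ (stdBasis j))

/-- The matrix unit `e_{ij}`, as a compact operator. -/
def compactUnit (i j : ℕ) : compacts := ⟨matrixUnit i j, matrixUnit_mem i j⟩

theorem rankOne_mem {S : Submodule ℂ (EllTwo →L[ℂ] EllTwo)}
    (hS : IsClosed (S : Set (EllTwo →L[ℂ] EllTwo))) (h : ∀ i j, matrixUnit i j ∈ S) (i : ℕ)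
    (y : EllTwo) : InnerProductSpace.rankOne ℂ (stdBasis i) y ∈ S := by
  have hy := stdBasis.hasSum_repr y
  have h2 := hy.map (InnerProductSpace.rankOne ℂ (stdBasis i)).toLinearMap.toAddMonoidHom
    (InnerProductSpace.rankOne ℂ (F := EllTwo) (stdBasis i)).continuous
  refine hS.mem_of_tendsto h2 (Filter.Eventually.of_forall fun F => ?_)
  refine S.sum_mem fun j _ => ?_
  -- The conjugate appears because `rankOne` is conjugate-linear in its second vector.
  have h3 := S.smul_mem (star (stdBasis.repr y j)) (h i j)
  have h4 := (InnerProductSpace.rankOne ℂ (F := EllTwo) (stdBasis i)).map_smulₛₗ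
    (stdBasis.repr y j) (stdBasis j)
  change InnerProductSpace.rankOne ℂ (stdBasis i) (stdBasis.repr y j • stdBasis j) ∈ S
  rw [h4]
  exact h3

/-- The projections `P F` onto finitely many basis vectors are contractions tending strongly to `1`,
hence uniformly on the totally bounded image of the unit ball; so `P F * k → k` in norm. Each
`e_{ii} k` is the rank one operator of `e_i` and `k* e_i`. -/
theorem compacts_le {S : Submodule ℂ (EllTwo →L[ℂ] EllTwo)}
    (hS : IsClosed (S : Set (EllTwo →L[ℂ] EllTwo))) (h : ∀ i j, matrixUnit i j ∈ S)
    {k : EllTwo →L[ℂ] EllTwo} (hk : k ∈ compacts) : k ∈ S := by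
  have hk : IsCompactOperator (k : EllTwo →ₗ[ℂ] EllTwo) := hk
  let P : Finset ℕ → EllTwo →L[ℂ] EllTwo := fun F => ∑ i ∈ F, matrixUnit i i
  have hP : ∀ F y, P F y = ∑ i ∈ F, stdBasis.repr y i • stdBasis i := fun F y => by
    simp only [P, _root_.sum_apply]
    refine Finset.sum_congr rfl fun i _ => ?_
    rw [matrixUnit, InnerProductSpace.rankOne_apply, stdBasis.repr_apply_apply]
  have hPn : ∀ F, ‖P F‖ ≤ 1 := fun F => by
    refine IsStarProjection.norm_le (P F) ⟨?_, ?_⟩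
    · simp only [IsIdempotentElem, P, Finset.sum_mul_sum]
      refine Finset.sum_congr rfl fun i hi => ?_
      rw [Finset.sum_eq_single_of_mem i hi fun j _ hj => matrixUnit_mul_of_ne i hj.symm j,
        matrixUnit_mul]
    · rw [IsSelfAdjoint, star_sum]
      exact Finset.sum_congr rfl fun i _ => star_matrixUnit i i
  have hPt : ∀ y, Filter.Tendsto (fun F => P F y) Filter.atTop (nhds y) := fun y => by
    simp only [hP]
    exact stdBasis.hasSum_repr y
  have hlim : Filter.Tendsto (fun F => P F * k) Filter.atTop (nhds k) := by
    rw [Metric.tendsto_atTop]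
    intro ε hε
    obtain ⟨Y, hY, hcov⟩ := Metric.totallyBounded_iff.1
      ((hk.isCompact_closure_image_closedBall 1).totallyBounded.subset subset_closure) (ε / 4)
      (by positivity)
    have hev : ∀ᶠ F in Filter.atTop, ∀ y ∈ Y, dist (P F y) y < ε / 4 :=
      (Filter.eventually_all_finite hY).2 fun y _ => Metric.tendsto_nhds.1 (hPt y) _ (by positivity)
    obtain ⟨F₀, hF₀⟩ := Filter.eventually_atTop.1 hev
    refine ⟨F₀, fun F hF => ?_⟩
    rw [dist_eq_norm]
    -- Three errors, each below `ε/4`: `P F (k x - y)`, `P F y - y` and `k x - y`.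
    refine lt_of_le_of_lt (ContinuousLinearMap.opNorm_le_of_unit_norm (𝕜 := ℂ)
      (C := 3 * (ε / 4)) (by positivity) fun x hx => ?_) (by linarith)
    obtain ⟨y, hy, hxy⟩ := Set.mem_iUnion₂.1 (hcov ⟨x, by simp [hx], rfl⟩)
    have hxy : ‖k x - y‖ < ε / 4 := by rw [← dist_eq_norm]; exact hxy
    have h1 : ‖P F (k x - y)‖ ≤ ‖k x - y‖ := by
      simpa using (P F).le_of_opNorm_le (hPn F) (k x - y)
    have h2 : ‖P F y - y‖ < ε / 4 := by rw [← dist_eq_norm]; exact hF₀ F hF y hy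
    have h3 : (P F * k - k) x = P F (k x - y) + (P F y - y) - (k x - y) := by
      change P F (k x) - k x = _
      rw [map_sub]; abel
    rw [h3]
    refine (norm_sub_le _ _).trans ?_
    have := norm_add_le (P F (k x - y)) (P F y - y)
    linarith
  refine hS.mem_of_tendsto hlim (Filter.Eventually.of_forall fun F => ?_)
  rw [Finset.sum_mul]
  refine S.sum_mem fun i _ => ?_
  have : matrixUnit i i * k = InnerProductSpace.rankOne ℂ (stdBasis i)
      (ContinuousLinearMap.adjoint k (stdBasis i)) := by
    ext1 x
    change matrixUnit i i (k x) = _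
    rw [matrixUnit, InnerProductSpace.rankOne_apply, InnerProductSpace.rankOne_apply,
      ContinuousLinearMap.adjoint_inner_left]
  rw [this]
  exact rankOne_mem hS h i _

end MatrixUnits

/-! ### The amplification of a Hilbert space -/

section Amplification

open TensorProduct UniformSpace

/-- The Hilbert space tensor product of `H` and `ℓ²(ℕ)`. -/
def Hilb.amp (H : Hilb) : Hilb := ⟨Completion (H.carrier ⊗[ℂ] EllTwo)⟩

namespace Amp

variable (H : Hilb)

/-- The pure tensor `x ⊗ y`, linear in `x`. -/
def pure (y : EllTwo) : H.carrier →L[ℂ] H.amp.carrier :=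
  (Completion.toComplL (𝕜 := ℂ) (E := H.carrier ⊗[ℂ] EllTwo)).comp
    ((TensorProduct.mkL ℂ H.carrier EllTwo).flip y)

variable {H}

theorem pure_apply (x : H.carrier) (y : EllTwo) :
    pure H y x = ((x ⊗ₜ[ℂ] y : H.carrier ⊗[ℂ] EllTwo) : Completion (H.carrier ⊗[ℂ] EllTwo)) := rfl

theorem pure_zero : pure H 0 = 0 := by
  ext1 x
  rw [pure_apply, tmul_zero]; rfl

theorem inner_pure (x x' : H.carrier) (y y' : EllTwo) :
    inner ℂ (pure H y x) (pure H y' x') = inner ℂ x x' * inner ℂ y y' :=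
  (Completion.inner_coe _ _).trans (TensorProduct.inner_tmul _ _ _ _ _)

theorem hom_ext {E : Type*} [NormedAddCommGroup E] [NormedSpace ℂ E] {f g : H.amp.carrier →L[ℂ] E}
    (h : ∀ x y, f (pure H y x) = g (pure H y x)) : f = g := by
  ext1 z
  refine Completion.induction_on (p := fun z : Completion (H.carrier ⊗[ℂ] EllTwo) => f z = g z) z
    (isClosed_eq f.continuous g.continuous) fun a => ?_
  induction a using TensorProduct.induction_on with
  | zero => exact (map_zero f).trans (map_zero g).symm
  | tmul x y => exact h x y
  | add a b ha hb =>
    have : ((a + b : H.carrier ⊗[ℂ] EllTwo) : Completion (H.carrier ⊗[ℂ] EllTwo)) = a + b :=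
      Completion.coe_add a b
    rw [this]
    exact (map_add f _ _).trans ((congrArg₂ (· + ·) ha hb).trans (map_add g _ _).symm)

/-- The operator `T ⊗ k`. -/
def map (T : H.B) (k : EllTwo →L[ℂ] EllTwo) : H.amp.B :=
  (TensorProduct.mapL T k).completion

theorem map_pure (T : H.B) (k : EllTwo →L[ℂ] EllTwo) (x : H.carrier) (y : EllTwo) :
    map T k (pure H y x) = pure H (k y) (T x) :=
  ContinuousLinearMap.completion_apply_coe _ _

theorem pure_add (y y' : EllTwo) (x : H.carrier) :
    pure H (y + y') x = pure H y x + pure H y' x := by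
  rw [pure, map_add, ContinuousLinearMap.comp_add]; rfl

theorem pure_smul (c : ℂ) (y : EllTwo) (x : H.carrier) : pure H (c • y) x = c • pure H y x := by
  rw [pure, map_smul, ContinuousLinearMap.comp_smul]; rfl

theorem map_mul_map (T T' : H.B) (k k' : EllTwo →L[ℂ] EllTwo) :
    map T k * map T' k' = map (T * T') (k * k') :=
  hom_ext fun x y => by
    change map T k (map T' k' (pure H y x)) = _
    rw [map_pure, map_pure, map_pure]; rfl

theorem star_map (T : H.B) (k : EllTwo →L[ℂ] EllTwo) :
    star (map T k) = map (star T) (star k) := by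
  refine hom_ext fun x y => ext_inner_right ℂ fun z => ?_
  rw [ContinuousLinearMap.star_eq_adjoint, ContinuousLinearMap.adjoint_inner_left]
  -- Both sides are continuous and linear in `z`, so `z` may be taken to be a pure tensor.
  refine DFunLike.congr_fun (hom_ext (f := (innerSL ℂ (pure H y x)).comp (map T k))
    (g := innerSL ℂ (map (star T) (star k) (pure H y x))) fun x' y' => ?_) z
  change inner ℂ (pure H y x) (map T k (pure H y' x')) =
    inner ℂ (map (star T) (star k) (pure H y x)) (pure H y' x')
  rw [map_pure, map_pure, inner_pure, inner_pure, ContinuousLinearMap.star_eq_adjoint,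
    ContinuousLinearMap.star_eq_adjoint, ContinuousLinearMap.adjoint_inner_left,
    ContinuousLinearMap.adjoint_inner_left]

/-- The representation `T ↦ T ⊗ 1`. -/
def left : H.B →⋆ₙₐ[ℂ] H.amp.B where
  toFun T := map T 1
  map_smul' c T := hom_ext fun x y => by
    change _ = c • map T 1 (pure H y x)
    rw [map_pure, map_pure, ← map_smul]; rfl
  map_zero' := hom_ext fun x y => by
    rw [map_pure]; exact map_zero _
  map_add' T T' := hom_ext fun x y => by
    change _ = map T 1 (pure H y x) + map T' 1 (pure H y x)
    rw [map_pure, map_pure, map_pure, ← map_add]; rfl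
  map_mul' T T' := by rw [map_mul_map, one_mul]
  map_star' T := by rw [star_map, star_one]

/-- The representation `k ↦ 1 ⊗ k`. -/
def right : (EllTwo →L[ℂ] EllTwo) →⋆ₙₐ[ℂ] H.amp.B where
  toFun k := map 1 k
  map_smul' c k := hom_ext fun x y => by
    change _ = c • map 1 k (pure H y x)
    rw [map_pure, map_pure, ← pure_smul]; rfl
  map_zero' := hom_ext fun x y => by
    rw [map_pure]
    change pure H 0 _ = 0
    rw [pure_zero]; rfl
  map_add' k k' := hom_ext fun x y => by
    change _ = map 1 k (pure H y x) + map 1 k' (pure H y x)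
    rw [map_pure, map_pure, map_pure, ← pure_add]; rfl
  map_mul' k k' := by rw [map_mul_map, one_mul]
  map_star' k := by rw [star_map, star_one]

theorem left_mul_right (T : H.B) (k : EllTwo →L[ℂ] EllTwo) : left T * right k = map T k :=
  (map_mul_map _ _ _ _).trans (by rw [one_mul, mul_one])

theorem commute_left_right (T : H.B) (k : EllTwo →L[ℂ] EllTwo) : Commute (left T) (right k) :=
  (left_mul_right T k).trans ((map_mul_map 1 T k 1).trans (by rw [one_mul, mul_one])).symm

end Amp

end Amplification

/-! ### Elementary tensors -/

section ElementaryTensors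

variable {A : Type u} {B : Type v} [NonUnitalCStarAlgebra A] [NonUnitalCStarAlgebra B]

namespace CStarTensor

/-- The representation of the tensor product given by a commuting pair of representations. -/
def eval (ρ : CommutingPair A B) : CStarTensor A B →⋆ₙₐ[ℂ] ρ.H.B :=
  OperatorAlgebra.eval (K := fun ρ : CommutingPair A B => ρ.H) {x | ∃ a b, x = tmul a b} ρ

theorem ext_eval {x y : CStarTensor A B} (h : ∀ ρ, eval ρ x = eval ρ y) : x = y :=
  Subtype.ext (lp.ext (funext h))

theorem norm_le_of_eval {x : CStarTensor A B} {C : ℝ} (hC : 0 ≤ C) (h : ∀ ρ, ‖eval ρ x‖ ≤ C) :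
    ‖x‖ ≤ C :=
  lp.norm_le_of_forall_le hC h

/-- The elementary tensor `a ⊗ b`. -/
def elem (a : A) (b : B) : CStarTensor A B :=
  ⟨tmul a b, subset_closedStarSpan _ ⟨a, b, rfl⟩⟩

theorem eval_elem (ρ : CommutingPair A B) (a : A) (b : B) : eval ρ (elem a b) = ρ.π a * ρ.σ b := rfl

theorem induction {S : NonUnitalStarSubalgebra ℂ (CStarTensor A B)}
    (hS : IsClosed (S : Set (CStarTensor A B))) (h : ∀ a b, elem a b ∈ S)
    (x : CStarTensor A B) : x ∈ S :=
  closedStarSpan_induction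
    (s := {x : lp (fun ρ : CommutingPair A B => ρ.H.B) ∞ | ∃ a b, x = tmul a b}) hS
    (by rintro _ ⟨a, b, rfl⟩; exact h a b) x

theorem star_elem (a : A) (b : B) : star (elem a b) = elem (star a) (star b) :=
  ext_eval fun ρ => by
    rw [map_star, eval_elem, eval_elem, star_mul, ← map_star, ← map_star]
    exact ((ρ.comm _ _).eq).symm

theorem elem_mul_elem (a a' : A) (b b' : B) : elem a b * elem a' b' = elem (a * a') (b * b') :=
  ext_eval fun ρ => by
    rw [map_mul, eval_elem, eval_elem, eval_elem, map_mul, map_mul, mul_assoc,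
      ← mul_assoc (ρ.σ b), ← (ρ.comm a' b).eq]
    simp only [mul_assoc]

theorem norm_elem_le (a : A) (b : B) : ‖elem a b‖ ≤ ‖a‖ * ‖b‖ :=
  norm_le_of_eval (by positivity) fun ρ => (norm_mul_le _ _).trans
    (mul_le_mul (NonUnitalStarAlgHom.norm_apply_le ρ.π a)
      (NonUnitalStarAlgHom.norm_apply_le ρ.σ b) (norm_nonneg _) (norm_nonneg _))

/-- The map `a ↦ a ⊗ b`. -/
def elemLeft (b : B) : A →L[ℂ] CStarTensor A B :=
  LinearMap.mkContinuous
    { toFun := fun a => elem a b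
      map_add' := fun a a' => ext_eval fun ρ => by
        rw [map_add, eval_elem, eval_elem, eval_elem, map_add, add_mul]
      map_smul' := fun c a => ext_eval fun ρ => by
        rw [map_smul, eval_elem, eval_elem, map_smul, smul_mul_assoc]; rfl } ‖b‖
    fun a => (norm_elem_le a b).trans_eq (mul_comm _ _)

/-- The map `b ↦ a ⊗ b`. -/
def elemRight (a : A) : B →L[ℂ] CStarTensor A B :=
  LinearMap.mkContinuous
    { toFun := fun b => elem a b
      map_add' := fun b b' => ext_eval fun ρ => by
        rw [map_add, eval_elem, eval_elem, eval_elem, map_add, mul_add]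
      map_smul' := fun c b => ext_eval fun ρ => by
        rw [map_smul, eval_elem, eval_elem, map_smul, mul_smul_comm]; rfl } ‖a‖
    fun b => norm_elem_le a b

theorem elemLeft_apply (a : A) (b : B) : elemLeft b a = elem a b := rfl

end CStarTensor

/-- A closed `*`-subalgebra of `A ⊗ 𝒦` contains everything if it contains the elementary tensors of
generators of `A` with matrix units. -/
theorem Stabilization.eq_top_of_generators {S : NonUnitalStarSubalgebra ℂ (Stabilization A)}
    (hS : IsClosed (S : Set (Stabilization A)))
    (hA : ∀ a i j, CStarTensor.elem a (compactUnit i j) ∈ S) (x : Stabilization A) : x ∈ S := by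
  refine CStarTensor.induction hS (fun a k => ?_) x
  let V : Submodule ℂ compacts :=
    S.toNonUnitalSubalgebra.toSubmodule.comap (CStarTensor.elemRight a).toLinearMap
  have hV : IsClosed (V : Set compacts) := hS.preimage (CStarTensor.elemRight a).continuous
  have hcl : IsClosed (compacts : Set (EllTwo →L[ℂ] EllTwo)) := inferInstance
  have hV' : IsClosed ((V.map compacts.toNonUnitalSubalgebra.toSubmodule.subtype :
      Submodule ℂ (EllTwo →L[ℂ] EllTwo)) : Set (EllTwo →L[ℂ] EllTwo)) :=
    hcl.isClosedEmbedding_subtypeVal.isClosedMap _ hV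
  obtain ⟨k', hk', he⟩ := compacts_le hV' (fun i j => ⟨compactUnit i j, hA a i j, rfl⟩) k.2
  obtain rfl : k' = k := Subtype.ext he
  exact hk'

end ElementaryTensors

/-! ### Stabilization amounts to infinite multiplicity of the decorations -/

theorem star_compactUnit (i j : ℕ) : star (compactUnit i j) = compactUnit j i :=
  Subtype.ext (star_matrixUnit i j)

theorem compactUnit_mul (i j k : ℕ) : compactUnit i j * compactUnit j k = compactUnit i k :=
  Subtype.ext (matrixUnit_mul i j k)

theorem compactUnit_mul_of_ne (i : ℕ) {j j' : ℕ} (h : j ≠ j') (l : ℕ) :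
    compactUnit i j * compactUnit j' l = 0 :=
  Subtype.ext (matrixUnit_mul_of_ne i h l)

section Stabilization

variable {r : ℕ} {A : Type u} {M : Fin r → Matrix A A ℕ} {D : Type v}

/-- The decoration in which each `d ∈ D` is repeated infinitely often. -/
abbrev multiple (δ : D → A) : D × ℕ → A := fun p => δ p.1

namespace DWord

variable {δ : D → A}

/-- The decorated word with the copy number forgotten. -/
def forget (u : DWord M (multiple δ)) : DWord M δ := ⟨u.shape, u.dec.1, u.word, u.o_eq⟩

/-- The copy of a decorated word with number `i`. -/
def tag (u : DWord M δ) (i : ℕ) : DWord M (multiple δ) := ⟨u.shape, (u.dec, i), u.word, u.o_eq⟩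

theorem forget_t_congr {u v : DWord M (multiple δ)} (h : u.t = v.t) : u.forget.t = v.forget.t := h

theorem tag_t_congr {u v : DWord M δ} (h : u.t = v.t) (i j : ℕ) : (u.tag i).t = (v.tag j).t := h

theorem vertex_t_congr {d d' : D} (h : δ d = δ d') : (vertex M δ d).t = (vertex M δ d').t := h

theorem retag_t_congr {u v : DWord M (multiple δ)} (h : u.t = v.t) (i : ℕ) :
    (u.forget.tag i).t = v.t := h

theorem retag_t_congr' {u v : DWord M (multiple δ)} (h : u.t = v.t) (i : ℕ) :
    u.t = (v.forget.tag i).t := h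

theorem tag_ne_tag {u v : DWord M δ} (h : u ≠ v) (i j : ℕ) : u.tag i ≠ v.tag j :=
  fun he => h (congrArg forget he)

theorem ne_of_shape_zero {u v : DWord M δ} (hu : u.shape = 0) (hv : v.shape = 0) (h : u ≠ v) :
    u.dec ≠ v.dec := fun hd => h (by rw [eq_vertex hu, eq_vertex hv, hd])

end DWord

variable [Finite A] {h1 : UniqueProducts M}

namespace Relations

variable {δ : D → A} {H : Type*} [NormedAddCommGroup H] [InnerProductSpace ℂ H] [CompleteSpace H]

/-- Expanding `s_{u,v}` over the words of the shape of `w`, only the term with `vw` on the right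
survives. -/
theorem mul_mul_extend {s : ∀ u v : DWord M δ, u.t = v.t → H →L[ℂ] H} (hs : Relations h1 δ s)
    (u v x : DWord M δ) (h : u.t = v.t) {n : Fin r → ℕ} (w : Word M n) (hw : w.o = v.t)
    (hx : (v.mul h1 w hw).t = x.t) :
    s u v h * s (v.mul h1 w hw) x hx = s (u.mul h1 w (hw.trans h.symm)) x
      (((u.mul_t h1 _ _).trans (v.mul_t h1 w hw).symm).trans hx) := by
  rw [hs.sum_words n u v v.t h rfl, Finset.sum_mul,
    Finset.sum_eq_single_of_mem (⟨w, hw⟩ : Words M n v.t) (Finset.mem_univ _), hs.mul_eq]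
  intro w' _ hw'
  exact hs.mul_mul_eq_zero _ _ ((hs.sum_projections v n).2 w' ⟨w, hw⟩ hw')

theorem mul_eq_zero_of_inner_dec_ne {s : ∀ u v : DWord M δ, u.t = v.t → H →L[ℂ] H}
    (hs : Relations h1 δ s) {u v x y : DWord M δ}
    (hd : v.dec ≠ x.dec) (h : u.t = v.t) (h' : x.t = y.t) : s u v h * s x y h' = 0 :=
  hs.mul_mul_eq_zero _ _ (hs.mul_eq_zero_of_dec_ne hd)

variable {T : ∀ u v : DWord M (multiple δ), u.t = v.t → H →L[ℂ] H}

/-- The partial isometry between two copies of a vertex changes the copy number of every word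
starting there. -/
theorem vertex_tag_mul (hs : Relations h1 (multiple δ) T) (i : ℕ) (u v : DWord M (multiple δ))
    (h : u.t = v.t) :
    T (.vertex M _ (u.dec.1, i)) (.vertex M _ u.dec) (DWord.vertex_t_congr rfl) * T u v h =
      T (u.forget.tag i) v (DWord.retag_t_congr h i) := by
  obtain ⟨h₁, hu₁⟩ := u.exists_eq_vertex_mul h1
  obtain ⟨h₂, hu₂⟩ := (u.forget.tag i).exists_eq_vertex_mul h1
  have key := hs.mul_mul_extend (.vertex M _ (u.dec.1, i)) (.vertex M _ u.dec) v
    (DWord.vertex_t_congr rfl) u.word h₁ ((congrArg DWord.t hu₁).trans h)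
  rw [family_congr T hu₁ rfl _ h] at key
  rw [key]
  exact family_congr T hu₂ rfl _ _

theorem mul_vertex_tag (hs : Relations h1 (multiple δ) T) (i : ℕ) (u v : DWord M (multiple δ))
    (h : u.t = v.t) :
    T u (v.forget.tag i) (DWord.retag_t_congr' h i) *
      T (.vertex M _ (v.dec.1, i)) (.vertex M _ v.dec) (DWord.vertex_t_congr rfl) = T u v h := by
  have key := congrArg star (hs.vertex_tag_mul v.dec.2 (v.forget.tag i) u
    (DWord.retag_t_congr h.symm i))
  rw [star_mul, hs.star_eq, hs.star_eq, hs.star_eq] at key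
  exact key

theorem corner (hs : Relations h1 (multiple δ) T) :
    Relations h1 δ (fun u v h => T (u.tag 0) (v.tag 0) (DWord.tag_t_congr h 0 0)) where
  star_eq _ _ _ := hs.star_eq _ _ _
  mul_eq _ _ _ _ _ := hs.mul_eq _ _ _ _ _
  sum_eq u v h j := hs.sum_eq (u.tag 0) (v.tag 0) (DWord.tag_t_congr h 0 0) j
  orthogonal u v hu hv huv := hs.orthogonal (u.tag 0) (v.tag 0) hu hv (DWord.tag_ne_tag huv 0 0)

end Relations

namespace CStarTensor

variable {B : Type*} {C : Type*} [NonUnitalCStarAlgebra B] [NonUnitalCStarAlgebra C]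

/-- The tensor product, as an algebra of bounded families of operators. -/
def ofOperatorAlgebra : OperatorAlgebra (K := fun ρ : CommutingPair B C => ρ.H)
    {x | ∃ a b, x = tmul a b} →⋆ₙₐ[ℂ] CStarTensor B C where
  toFun x := x
  map_smul' _ _ := rfl
  map_zero' := rfl
  map_add' _ _ := rfl
  map_mul' _ _ := rfl
  map_star' _ := rfl

/-- A family of elements of a tensor product which satisfies the relations in each representation
defines a homomorphism. -/
def lift {δ : D → A} (x : ∀ u v : DWord M δ, u.t = v.t → CStarTensor B C)
    (rel : ∀ ρ, Relations h1 δ (fun u v h => eval ρ (x u v h))) :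
    TilingAlgebra h1 δ →⋆ₙₐ[ℂ] CStarTensor B C :=
  ofOperatorAlgebra.comp (TilingAlgebra.lift (K := fun ρ : CommutingPair B C => ρ.H)
    {x | ∃ a b, x = tmul a b} x rel)

theorem lift_s {δ : D → A} (x : ∀ u v : DWord M δ, u.t = v.t → CStarTensor B C)
    (rel : ∀ ρ, Relations h1 δ (fun u v h => eval ρ (x u v h))) (u v : DWord M δ) (h : u.t = v.t) :
    lift x rel (TilingAlgebra.s h1 δ u v h) = x u v h := rfl

end CStarTensor

open CStarTensor in
-- Distinct vertices `(d,i)` differ in `d`, and the first tensor factors are orthogonal, or share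
-- `d` and differ in `i`, and the matrix units are.
theorem relations_elem (h1 : UniqueProducts M) (δ : D → A) : Relations h1 (multiple δ) (fun u v h =>
    elem (TilingAlgebra.s h1 δ u.forget v.forget (DWord.forget_t_congr h))
      (compactUnit u.dec.2 v.dec.2)) where
  star_eq u v h := by rw [star_elem, TilingAlgebra.relations.star_eq, star_compactUnit]
  mul_eq u v w h h' := by rw [elem_mul_elem, TilingAlgebra.relations.mul_eq, compactUnit_mul]
  sum_eq u v h j := by
    have := congrArg (elemLeft (compactUnit u.dec.2 v.dec.2))
      (TilingAlgebra.relations.sum_eq u.forget v.forget (DWord.forget_t_congr h) j :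
        TilingAlgebra.s h1 δ _ _ _ = _)
    rw [map_sum] at this
    exact this
  orthogonal u v hu hv huv := by
    have hd := DWord.ne_of_shape_zero hu hv huv
    rw [elem_mul_elem]
    by_cases h : u.dec.1 = v.dec.1
    · rw [compactUnit_mul_of_ne _ (fun h' => hd (Prod.ext h h'))]
      exact map_zero (elemRight _)
    · rw [TilingAlgebra.relations.orthogonal u.forget v.forget hu hv
        (fun he => h (by have := congrArg DWord.dec he; exact this))]
      exact map_zero (elemLeft _)

theorem relations_eval_elem (δ : D → A) (ρ : CommutingPair (TilingAlgebra h1 δ) compacts) :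
    Relations h1 (multiple δ) (fun u v h => CStarTensor.eval ρ
      (CStarTensor.elem (TilingAlgebra.s h1 δ u.forget v.forget (DWord.forget_t_congr h))
        (compactUnit u.dec.2 v.dec.2))) :=
  (relations_elem h1 δ).map (CStarTensor.eval ρ)

/-- The homomorphism `s_{(u,i),(v,j)} ↦ s_{u,v} ⊗ e_{ij}`. -/
def stabHom (h1 : UniqueProducts M) (δ : D → A) :
    TilingAlgebra h1 (multiple δ) →⋆ₙₐ[ℂ] Stabilization (TilingAlgebra h1 δ) :=
  CStarTensor.lift
    (fun u v h => CStarTensor.elem (TilingAlgebra.s h1 δ u.forget v.forget (DWord.forget_t_congr h))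
      (compactUnit u.dec.2 v.dec.2))
    (relations_eval_elem δ)

theorem stabHom_s {δ : D → A} (u v : DWord M (multiple δ)) (h : u.t = v.t) :
    stabHom h1 δ (TilingAlgebra.s h1 _ u v h) =
      CStarTensor.elem (TilingAlgebra.s h1 δ u.forget v.forget (DWord.forget_t_congr h))
        (compactUnit u.dec.2 v.dec.2) := CStarTensor.lift_s _ _ _ _ _

end Stabilization

/-! ### Isometry and surjectivity of the stabilization map -/

section Stabilization

variable {r : ℕ} {A : Type u} {M : Fin r → Matrix A A ℕ} {D : Type v} [Finite A]
  {h1 : UniqueProducts M}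

section Amplify

variable {δ : D → A} (ρ : Rep h1 (multiple δ))

/-- The representation of `𝒜_D` in the corner of index `0`. -/
def cornerRep : Rep h1 δ :=
  ⟨ρ.H, fun u v h => ρ.S (u.tag 0) (v.tag 0) (DWord.tag_t_congr h 0 0), ρ.rel.corner⟩

/-- The amplification of the representation in the corner of index `0`. -/
def ampPair : CommutingPair (TilingAlgebra h1 δ) compacts where
  H := ρ.H.amp
  π := (Amp.left (H := ρ.H)).comp (TilingAlgebra.eval (cornerRep ρ))
  σ := (Amp.right (H := ρ.H)).comp (NonUnitalStarSubalgebraClass.subtype compacts)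
  comm _ _ := Amp.commute_left_right _ _

/-- The representation of `𝒜_{D × ℕ}` given by the amplification. -/
def ampHom : TilingAlgebra h1 (multiple δ) →⋆ₙₐ[ℂ] ρ.H.amp.B :=
  (CStarTensor.eval (ampPair ρ)).comp (stabHom h1 δ)

theorem ampHom_apply (a : TilingAlgebra h1 (multiple δ)) :
    ampHom ρ a = CStarTensor.eval (ampPair ρ) (stabHom h1 δ a) := rfl

theorem ampHom_s (u v : DWord M (multiple δ)) (h : u.t = v.t) :
    ampHom ρ (TilingAlgebra.s h1 _ u v h) =
      Amp.map (ρ.S (u.forget.tag 0) (v.forget.tag 0)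
        (DWord.tag_t_congr (DWord.forget_t_congr h) 0 0)) (matrixUnit u.dec.2 v.dec.2) :=
  Amp.left_mul_right _ _

/-- The partial isometry `h ↦ ∑ S_{(d,0),(d,i)} h ⊗ e_i`, the sum over finitely many `(d,i)`. -/
def intertwiner (F : Finset (D × ℕ)) : ρ.H.carrier →L[ℂ] ρ.H.amp.carrier :=
  ∑ p ∈ F, (Amp.pure ρ.H (stdBasis p.2)).comp
    (ρ.S (.vertex M _ (p.1, 0)) (.vertex M _ p)
      (DWord.vertex_t_congr rfl))

/-- The projection `∑ S_{(d,i),(d,i)}`, the sum over finitely many `(d,i)`. -/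
def vertexProj (F : Finset (D × ℕ)) : ρ.H.B :=
  ∑ p ∈ F, ρ.S (.vertex M _ p) (.vertex M _ p) rfl

theorem intertwiner_apply (F : Finset (D × ℕ)) (x : ρ.H.carrier) :
    intertwiner ρ F x = ∑ p ∈ F, Amp.pure ρ.H (stdBasis p.2)
      (ρ.S (.vertex M _ (p.1, 0)) (.vertex M _ p)
      (DWord.vertex_t_congr rfl) x) := by
  rw [intertwiner, _root_.sum_apply]; rfl

theorem star_vertexProj (F : Finset (D × ℕ)) : star (vertexProj ρ F) = vertexProj ρ F := by
  rw [vertexProj, star_sum]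
  exact Finset.sum_congr rfl fun p _ => ρ.rel.star_eq _ _ _

theorem vertexProj_mul {F : Finset (D × ℕ)} {u v : DWord M (multiple δ)} (hu : u.dec ∈ F)
    (h : u.t = v.t) : vertexProj ρ F * ρ.S u v h = ρ.S u v h := by
  rw [vertexProj, Finset.sum_mul, Finset.sum_eq_single_of_mem _ hu]
  · exact ρ.rel.vertex_tag_mul u.dec.2 u v h
  · exact fun p _ hp => ρ.rel.mul_eq_zero_of_inner_dec_ne (v := .vertex M _ p) hp _ _

theorem vertexProj_mul_self (F : Finset (D × ℕ)) :
    vertexProj ρ F * vertexProj ρ F = vertexProj ρ F := by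
  conv_lhs => rw [vertexProj.eq_def ρ F]
  rw [Finset.mul_sum]
  exact Finset.sum_congr rfl fun p hp => vertexProj_mul ρ (u := .vertex M _ p) hp rfl

/-- For `V = intertwiner ρ F`, `V* V` is the vertex projection: of the cross terms, those with
different copy numbers vanish because the basis is orthonormal, those with different `d` because the
vertices are orthogonal. -/
theorem norm_intertwiner (F : Finset (D × ℕ)) (x : ρ.H.carrier) :
    ‖intertwiner ρ F x‖ = ‖vertexProj ρ F x‖ := by
  have key : inner ℂ (intertwiner ρ F x) (intertwiner ρ F x) =
      inner ℂ (vertexProj ρ F x) (vertexProj ρ F x) := by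
    have h2 : inner ℂ (vertexProj ρ F x) (vertexProj ρ F x) = inner ℂ x (vertexProj ρ F x) := by
      have h3 := ContinuousLinearMap.adjoint_inner_left (vertexProj ρ F) (vertexProj ρ F x) x
      rw [← ContinuousLinearMap.star_eq_adjoint, star_vertexProj] at h3
      rw [h3]
      exact congrArg _ (congrArg (fun T : ρ.H.B => T x) (vertexProj_mul_self ρ F))
    rw [h2, intertwiner_apply, sum_inner, vertexProj, _root_.sum_apply, inner_sum]
    refine Finset.sum_congr rfl fun p hp => ?_
    have h4 : ∀ q, inner ℂ
        (Amp.pure ρ.H (stdBasis p.2) (ρ.S (.vertex M _ (p.1, 0)) (.vertex M _ p)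
      (DWord.vertex_t_congr rfl) x))
        (Amp.pure ρ.H (stdBasis q.2) (ρ.S (.vertex M _ (q.1, 0)) (.vertex M _ q)
      (DWord.vertex_t_congr rfl) x)) =
        inner ℂ x ((ρ.S (.vertex M _ p) (.vertex M _ (p.1, 0))
      (DWord.vertex_t_congr rfl) *
          ρ.S (.vertex M _ (q.1, 0)) (.vertex M _ q)
      (DWord.vertex_t_congr rfl)) x) * (if p.2 = q.2 then 1 else 0) :=
      fun q => by
        rw [Amp.inner_pure, orthonormal_iff_ite.1 stdBasis.orthonormal]
        congr 1
        rw [← ρ.rel.star_eq (.vertex M _ (p.1, 0)) (.vertex M _ p)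
      (DWord.vertex_t_congr rfl),
          ContinuousLinearMap.star_eq_adjoint]
        exact (ContinuousLinearMap.adjoint_inner_right _ _ _).symm
    rw [inner_sum, Finset.sum_eq_single_of_mem p hp, h4, if_pos rfl, mul_one, ρ.rel.mul_eq]
    intro q _ hq
    rw [h4]
    by_cases h : p.1 = q.1
    · rw [if_neg (fun h' => hq (Prod.ext h h').symm), mul_zero]
    · rw [ρ.rel.mul_eq_zero_of_inner_dec_ne (v := .vertex M _ (p.1, 0)) (x := .vertex M _ (q.1, 0))
        (fun he => h (by have := congrArg Prod.fst he; exact this))]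
      simp
  rw [inner_self_eq_norm_sq_to_K, inner_self_eq_norm_sq_to_K] at key
  have h5 : ‖intertwiner ρ F x‖ ^ 2 = ‖vertexProj ρ F x‖ ^ 2 := by exact_mod_cast key
  exact (sq_eq_sq₀ (norm_nonneg _) (norm_nonneg _)).1 h5

theorem norm_intertwiner_le (F : Finset (D × ℕ)) (x : ρ.H.carrier) :
    ‖intertwiner ρ F x‖ ≤ ‖x‖ := by
  rw [norm_intertwiner]
  simpa using (vertexProj ρ F).le_of_opNorm_le
    (IsStarProjection.norm_le (vertexProj ρ F) ⟨vertexProj_mul_self ρ F, star_vertexProj ρ F⟩) x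

theorem intertwiner_s {F : Finset (D × ℕ)} {u v : DWord M (multiple δ)} (hu : u.dec ∈ F)
    (hv : v.dec ∈ F) (h : u.t = v.t) (x : ρ.H.carrier) :
    ampHom ρ (TilingAlgebra.s h1 _ u v h) (intertwiner ρ F x) =
      intertwiner ρ F (ρ.S u v h x) := by
  -- With `i` the copy number of `u`, both sides reduce to `S_{(u,0),v} x ⊗ e_i`: only the index
  -- `v.dec` contributes on the left and only `u.dec` on the right.
  trans Amp.pure ρ.H (stdBasis u.dec.2) (ρ.S (u.forget.tag 0) v (DWord.retag_t_congr h 0) x)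
  · rw [ampHom_s, intertwiner_apply, map_sum, Finset.sum_eq_single_of_mem _ hv]
    · rw [Amp.map_pure, matrixUnit_apply, if_pos rfl]
      exact congrArg _ (congrArg (fun T : ρ.H.B => T x)
        (ρ.rel.mul_vertex_tag 0 (u.forget.tag 0) v (DWord.retag_t_congr h 0)))
    · intro p _ hp
      rw [Amp.map_pure, matrixUnit_apply]
      by_cases h2 : v.dec.2 = p.2
      · have h3 : v.dec.1 ≠ p.1 := fun h3 => hp (Prod.ext h3 h2).symm
        have h4 := ρ.rel.mul_eq_zero_of_inner_dec_ne (u := u.forget.tag 0) (v := v.forget.tag 0)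
          (x := .vertex M _ (p.1, 0)) (y := .vertex M _ p)
          (fun he => h3 (by have := congrArg Prod.fst he; exact this))
          (DWord.tag_t_congr (DWord.forget_t_congr h) 0 0) (DWord.vertex_t_congr rfl)
        exact (congrArg _ (congrArg (fun T : ρ.H.B => T x) h4)).trans (map_zero _)
      · rw [if_neg h2, Amp.pure_zero]; rfl
  · rw [intertwiner_apply, Finset.sum_eq_single_of_mem _ hu]
    · exact congrArg _ (congrArg (fun T : ρ.H.B => T x) (ρ.rel.vertex_tag_mul 0 u v h)).symm
    · intro p _ hp
      have h4 := ρ.rel.mul_eq_zero_of_inner_dec_ne (u := .vertex M _ (p.1, 0)) (v := .vertex M _ p)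
        (x := u) (y := v) hp (DWord.vertex_t_congr rfl) h
      exact (congrArg _ (congrArg (fun T : ρ.H.B => T x) h4)).trans (map_zero _)

/-- The operators of `a` in the amplification and in `ρ` correspond under the intertwiner. -/
def Intertwines (F : Finset (D × ℕ)) (a : TilingAlgebra h1 (multiple δ)) : Prop :=
  (∀ x, ampHom ρ a (intertwiner ρ F x) = intertwiner ρ F (TilingAlgebra.eval ρ a x)) ∧
    ∀ x, vertexProj ρ F (TilingAlgebra.eval ρ a x) = TilingAlgebra.eval ρ a x

variable {ρ}

theorem Intertwines.add {F : Finset (D × ℕ)} {a b : TilingAlgebra h1 (multiple δ)}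
    (ha : Intertwines ρ F a) (hb : Intertwines ρ F b) : Intertwines ρ F (a + b) := by
  refine ⟨fun x => ?_, fun x => ?_⟩
  · rw [map_add, map_add]
    change ampHom ρ a _ + ampHom ρ b _ =
      intertwiner ρ F (TilingAlgebra.eval ρ a x + TilingAlgebra.eval ρ b x)
    rw [map_add, ha.1, hb.1]
  · rw [map_add]
    change vertexProj ρ F (TilingAlgebra.eval ρ a x + TilingAlgebra.eval ρ b x) =
      TilingAlgebra.eval ρ a x + TilingAlgebra.eval ρ b x
    rw [map_add, ha.2, hb.2]

theorem Intertwines.mul {F : Finset (D × ℕ)} {a b : TilingAlgebra h1 (multiple δ)}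
    (ha : Intertwines ρ F a) (hb : Intertwines ρ F b) : Intertwines ρ F (a * b) := by
  refine ⟨fun x => ?_, fun x => ?_⟩
  · rw [map_mul, map_mul]
    change ampHom ρ a (ampHom ρ b _) =
      intertwiner ρ F (TilingAlgebra.eval ρ a (TilingAlgebra.eval ρ b x))
    rw [hb.1, ha.1]
  · rw [map_mul]
    exact ha.2 _

theorem Intertwines.zero {F : Finset (D × ℕ)} : Intertwines ρ F 0 := by
  refine ⟨fun x => ?_, fun x => ?_⟩
  · rw [map_zero, map_zero]; exact (map_zero (intertwiner ρ F)).symm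
  · rw [map_zero]; exact map_zero (vertexProj ρ F)

theorem Intertwines.smul {F : Finset (D × ℕ)} {a : TilingAlgebra h1 (multiple δ)}
    (ha : Intertwines ρ F a) (c : ℂ) : Intertwines ρ F (c • a) := by
  refine ⟨fun x => ?_, fun x => ?_⟩
  · rw [map_smul, map_smul]
    change c • ampHom ρ a _ = intertwiner ρ F (c • TilingAlgebra.eval ρ a x)
    rw [map_smul, ha.1]
  · rw [map_smul]
    change vertexProj ρ F (c • TilingAlgebra.eval ρ a x) = c • TilingAlgebra.eval ρ a x
    rw [map_smul, ha.2]

/-- The intertwiner `V` preserves the norm of `ρ(a)x`, which lies in the range of the vertex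
projection, and it carries `ρ(a)x` to the amplified `a` applied to `Vx`, where `‖Vx‖ ≤ ‖x‖`. -/
theorem Intertwines.norm_le {F : Finset (D × ℕ)} {a : TilingAlgebra h1 (multiple δ)}
    (ha : Intertwines ρ F a) : ‖TilingAlgebra.eval ρ a‖ ≤ ‖ampHom ρ a‖ := by
  refine ContinuousLinearMap.opNorm_le_bound _ (norm_nonneg _) fun x => ?_
  rw [← ha.2 x, ← norm_intertwiner, ← ha.1 x]
  exact ((ampHom ρ a).le_opNorm _).trans
    (mul_le_mul_of_nonneg_left (norm_intertwiner_le ρ F x) (norm_nonneg _))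

variable (ρ)

/-- The elements which are eventually intertwined. -/
def intertwinedSubalgebra : NonUnitalStarSubalgebra ℂ (TilingAlgebra h1 (multiple δ)) where
  -- "Eventually in `F`" lets two elements share a finite set, and including `star a` makes the set
  -- closed under adjoints.
  carrier := {a | ∀ᶠ F in Filter.atTop, Intertwines ρ F a ∧ Intertwines ρ F (star a)}
  add_mem' ha hb := by
    filter_upwards [ha, hb] with F hF hF'
    exact ⟨hF.1.add hF'.1, by rw [star_add]; exact hF.2.add hF'.2⟩
  zero_mem' := Filter.Eventually.of_forall fun F => ⟨.zero, by rw [star_zero]; exact .zero⟩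
  mul_mem' ha hb := by
    filter_upwards [ha, hb] with F hF hF'
    exact ⟨hF.1.mul hF'.1, by rw [star_mul]; exact hF'.2.mul hF.2⟩
  smul_mem' c a ha := by
    filter_upwards [ha] with F hF
    exact ⟨hF.1.smul c, by rw [star_smul]; exact hF.2.smul _⟩
  star_mem' ha := by
    filter_upwards [ha] with F hF
    exact ⟨hF.2, by rw [star_star]; exact hF.1⟩

theorem s_mem_intertwinedSubalgebra (u v : DWord M (multiple δ)) (h : u.t = v.t) :
    TilingAlgebra.s h1 _ u v h ∈ intertwinedSubalgebra ρ := by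
  classical
  have key : ∀ (u v : DWord M (multiple δ)) (h : u.t = v.t) (F : Finset (D × ℕ)), u.dec ∈ F →
      v.dec ∈ F → Intertwines ρ F (TilingAlgebra.s h1 _ u v h) := fun u v h F hu hv =>
    ⟨intertwiner_s ρ hu hv h, fun x => congrArg (fun T : ρ.H.B => T x) (vertexProj_mul ρ hu h)⟩
  refine (Filter.eventually_ge_atTop {u.dec, v.dec}).mono fun F hF => ?_
  have hu : u.dec ∈ F := hF (by simp)
  have hv : v.dec ∈ F := hF (by simp)
  refine ⟨key u v h F hu hv, ?_⟩
  rw [TilingAlgebra.relations.star_eq]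
  exact key v u h.symm F hv hu

theorem norm_eval_le (a : TilingAlgebra h1 (multiple δ)) :
    ‖TilingAlgebra.eval ρ a‖ ≤ ‖ampHom ρ a‖ := by
  have ha : a ∈ (intertwinedSubalgebra ρ).topologicalClosure :=
    TilingAlgebra.induction (NonUnitalStarSubalgebra.isClosed_topologicalClosure _)
      (fun u v h => subset_closure (s_mem_intertwinedSubalgebra ρ u v h)) a
  refine closure_minimal (t := {a | ‖TilingAlgebra.eval ρ a‖ ≤ ‖ampHom ρ a‖}) ?_ ?_ ha
  · intro b hb
    obtain ⟨F, hF⟩ := Filter.Eventually.exists (f := Filter.atTop) hb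
    exact hF.1.norm_le
  · exact isClosed_le (continuous_starHom _).norm (continuous_starHom _).norm

theorem norm_ampHom_le (a : TilingAlgebra h1 (multiple δ)) :
    ‖ampHom ρ a‖ ≤ ‖stabHom h1 δ a‖ := by
  rw [ampHom_apply]
  exact NonUnitalStarAlgHom.norm_apply_le (CStarTensor.eval (ampPair ρ)) _

end Amplify

theorem norm_stabHom {δ : D → A} (a : TilingAlgebra h1 (multiple δ)) : ‖stabHom h1 δ a‖ = ‖a‖ := by
  refine le_antisymm (NonUnitalStarAlgHom.norm_apply_le _ _) ?_
  exact TilingAlgebra.norm_le_of_eval (norm_nonneg _) fun ρ => (norm_eval_le ρ a).trans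
    (norm_ampHom_le ρ a)

/-- An isometric image is complete, hence closed. The `a` with all `a ⊗ e_{ij}` in the range form a
closed `*`-subalgebra containing the generators. -/
theorem stabHom_surjective (h1 : UniqueProducts M) (δ : D → A) :
    Function.Surjective (stabHom h1 δ) := by
  have hiso : Isometry (stabHom h1 δ) := AddMonoidHomClass.isometry_of_norm _ norm_stabHom
  let R : NonUnitalStarSubalgebra ℂ (Stabilization (TilingAlgebra h1 δ)) :=
    NonUnitalStarAlgHom.range (stabHom h1 δ)
  have hR : IsClosed (R : Set (Stabilization (TilingAlgebra h1 δ))) :=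
    hiso.isClosedEmbedding.isClosed_range
  let S : NonUnitalStarSubalgebra ℂ (TilingAlgebra h1 δ) :=
    { carrier := {a | ∀ i j, CStarTensor.elem a (compactUnit i j) ∈ R}
      add_mem' := fun {a b} ha hb i j => by
        rw [← CStarTensor.elemLeft_apply, map_add]
        exact R.add_mem (ha i j) (hb i j)
      zero_mem' := fun i j => by
        rw [← CStarTensor.elemLeft_apply, map_zero]
        exact R.zero_mem
      mul_mem' := fun {a b} ha hb i j => by
        -- Products are handled by `ab ⊗ e_{ij} = (a ⊗ e_{ii})(b ⊗ e_{ij})`.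
        rw [← compactUnit_mul i i j, ← CStarTensor.elem_mul_elem]
        exact R.mul_mem (ha i i) (hb i j)
      smul_mem' := fun c a ha i j => by
        rw [← CStarTensor.elemLeft_apply, map_smul]
        exact SMulMemClass.smul_mem c (ha i j)
      star_mem' := fun {a} ha i j => by
        rw [← star_compactUnit, ← CStarTensor.star_elem]
        exact star_mem (ha j i) }
  have hS : IsClosed (S : Set (TilingAlgebra h1 δ)) := by
    have : (S : Set (TilingAlgebra h1 δ)) = ⋂ i, ⋂ j,
        CStarTensor.elemLeft (compactUnit i j) ⁻¹' (R : Set _) := by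
      ext a
      simp only [Set.mem_iInter]
      rfl
    rw [this]
    exact isClosed_iInter fun i => isClosed_iInter fun j =>
      hR.preimage (CStarTensor.elemLeft (compactUnit i j)).continuous
  have hall : ∀ a, a ∈ S := TilingAlgebra.induction hS fun u v h i j =>
    ⟨TilingAlgebra.s h1 _ (u.tag i) (v.tag j) h, stabHom_s (u.tag i) (v.tag j) h⟩
  exact fun x => Stabilization.eq_top_of_generators hR hall x

/-- The stabilization of `𝒜_D` is `𝒜_{D × ℕ}`. -/
def stabEquiv (h1 : UniqueProducts M) (δ : D → A) :
    TilingAlgebra h1 (multiple δ) ≃⋆ₐ[ℂ] Stabilization (TilingAlgebra h1 δ) :=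
  StarAlgEquiv.ofBijective (stabHom h1 δ)
    ⟨(AddMonoidHomClass.isometry_of_norm (stabHom h1 δ) norm_stabHom).injective,
      stabHom_surjective h1 δ⟩

theorem nonempty_stabilization_equiv (h1 : UniqueProducts M)
    (hirr : ∀ a b : A, Relation.ReflTransGen (fun a b => ∃ i, M i b a = 1) a b)
    [Countable D] [Nonempty D] (δ : D → A) :
    Nonempty (Stabilization (TilingAlgebra h1 δ) ≃⋆ₐ[ℂ]
      TilingAlgebra h1 (Prod.fst : A × ℕ → A)) := by
  obtain ⟨c⟩ := exists_refinement h1 hirr δ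
  exact ⟨(stabEquiv h1 δ).symm.trans c.equiv.symm⟩

end Stabilization

end HigherRankCK

end

theorem corollary5p13 {r : ℕ} {A : Type*} [Finite A] (M : Fin r → Matrix A A ℕ)
    (hM : HigherRankCK.TilingConditions M) :
    (∀ (D : Type*) [Countable D] [Nonempty D] (δ : D → A),
      Nonempty (HigherRankCK.Stabilization (HigherRankCK.TilingAlgebra hM.uniqueProducts δ) ≃⋆ₐ[ℂ]
        HigherRankCK.TilingAlgebra hM.uniqueProducts (Prod.fst : A × ℕ → A))) ∧
    (∀ (D : Type*) [Countable D] [Nonempty D] (δ : D → A)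
      (D' : Type*) [Countable D'] [Nonempty D'] (δ' : D' → A),
      Nonempty (HigherRankCK.Stabilization (HigherRankCK.TilingAlgebra hM.uniqueProducts δ) ≃⋆ₐ[ℂ]
        HigherRankCK.Stabilization (HigherRankCK.TilingAlgebra hM.uniqueProducts δ'))) := by
  refine ⟨fun D _ _ δ => HigherRankCK.nonempty_stabilization_equiv _ hM.irreducible δ,
    fun D _ _ δ D' _ _ δ' => ?_⟩
  obtain ⟨e⟩ := HigherRankCK.nonempty_stabilization_equiv hM.uniqueProducts hM.irreducible δ
  obtain ⟨e'⟩ := HigherRankCK.nonempty_stabilization_equiv hM.uniqueProducts hM.irreducible δ'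
  exact ⟨e.trans e'.symm⟩
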